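/- Let $n,d\ge 1$, let $v:\mathbb R^d\to\mathbb R^d$ be Lipschitz and bounded with flow $\Phi^v_t$, and let $\omega\subset\mathbb R^d$ be a bounded, open, connected set. An admissible control is a field $\mathbb 1_\omega u(x,t)$ that is Lipschitz in $x\in\mathbb R^d$ uniformly in $t$, measurable in $t$, and bounded; the agents move according to $\dot x_i=v(x_i)+\mathbb 1_\omega(x_i)u(x_i,t)$ for a.e. $t\ge 0$, $x_i(0)=x_i^0$ ($i=1,\dots,n$). Put $$t^0(x)=\inf\{t\ge 0:\Phi^v_t(x)\in\omega\},\qquad t^1(x)=\inf\{t\ge 0:\Phi^v_{-t}(x)\in\omega\}.$$ Let $X^0=(x^0_1,\dots,x^0_n)$ and $X^1=(x^1_1,\dots,x^1_n)$ be two configurations, each consisting of pairwise distinct points, such that for every $i$ there are $s,s'>0$ with $\Phi^v_{s}(x^0_i)\in\omega$ and $\Phi^v_{-s'}(x^1_i)\in\omega$, and numbered so that $t^0(x^0_i)$ is non-decreasing and $t^1(x^1_i)$ is non-increasing in $i$. Let $\gamma>0$, $0\le\varepsilon<\gamma$ and $R=\lfloor n\varepsilon/\gamma\rfloor$. We say that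 $X^0$ is exactly steered to $X^1$ up to a mass $\varepsilon$ (for a total mass $\gamma$) at time $T$ if there are an admissible control and permutations $\sigma_0,\sigma_1$ of $\{1,\dots,n\}$ with $x_{\sigma_0(i)}(T)=x^1_{\sigma_1(i)}$ for all $1\le i\le n-R$. Let $$M=\max_{1\le i\le n-R}\bigl(t^0(x^0_i)+t^1(x^1_{i+R})\bigr),\qquad M^*=\max_{1\le i\le n}\max\bigl(t^0(x^0_i),t^1(x^1_i)\bigr).$$ Then $M$ is the infimum time to exactly steer $X^0$ to $X^1$ up to a mass $\varepsilon$, in the following sense. 1. For every $T>M$, $X^0$ can be exactly steered to $X^1$ up to a mass $\varepsilon$ at time $T$. 2. For every $T\in(M^*,M]$ this is impossible. 3. The infimum of the times $T$ at which such a steering exists with $T>t^0(x^0_{\sigma_0(i)})$ and $T>t^1(x^1_{\sigma_1(i)})$ for all $1\le i\le n-R$ is equal to $M$. 4. The infimum of the times $T>M^*$ at which such a steering exists is equal to $\max(M^*,M)$ (hence to $M$ whenever $M^*\le M$, in particular if $\varepsilon<\gamma/n$). Moreover $M=S_\varepsilon(\mu^0,\mu^1)$ for the measures $\mu^l=\sum_{i=1}^n\frac{\gamma}{n}\delta_{x^l_i}$,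 $l=0,1$, where $$S_\varepsilon(\mu^0,\mu^1)=\sup_{m\in[0,\gamma-\varepsilon]}\bigl\{\mathcal F^{-1}_{\mu^0}(m)+\mathcal B^{-1}_{\mu^1}(\gamma-\varepsilon-m)\bigr\}$$ is the supremum of a bounded set, with $\mathcal F_{\mu}(t)=\mu(\{x\in\operatorname{supp}\mu:t^0(x)\le t\})$, $\mathcal B_{\mu}(t)=\mu(\{x\in\operatorname{supp}\mu:t^1(x)\le t\})$ and $G^{-1}(m)=\inf\{t\ge 0:G(t)\ge m\}$. -/

import Mathlib

open MeasureTheory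
open scoped NNReal

namespace CrowdControl

noncomputable section

/-- The state space `ℝᵈ` with its Euclidean norm. -/
abbrev State (d : ℕ) : Type := EuclideanSpace ℝ (Fin d)

variable {d n : ℕ}

/-! ### The uncontrolled flow and the entrance times -/

/-- The flow `Φ_t^v(x)`, `t ∈ ℝ`, of an autonomous vector field `v`: the value at time `t` of a
solution on `ℝ` of `γ' = v(γ)`, `γ(0) = x`.  It is meant for bounded Lipschitz fields `v`, for which
this solution exists and is unique. -/
def flow (v : State d → State d) (t : ℝ) (x : State d) : State d :=
  open Classical in
  if h : ∃ γ : ℝ → State d, γ 0 = x ∧ IsIntegralCurve γ (fun _ => v) then h.choose t else x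

/-- `t⁰(x) = inf {t ≥ 0 : Φ_t^v(x) ∈ ω}`. -/
def entranceTime (v : State d → State d) (ω : Set (State d)) (x : State d) : ℝ :=
  sInf {t : ℝ | 0 ≤ t ∧ flow v t x ∈ ω}

/-- `t¹(x) = inf {t ≥ 0 : Φ_{-t}^v(x) ∈ ω}`. -/
def backwardEntranceTime (v : State d → State d) (ω : Set (State d)) (x : State d) : ℝ :=
  sInf {t : ℝ | 0 ≤ t ∧ flow v (-t) x ∈ ω}

/-- The geometric condition: every point of `supp μ⁰` crosses `ω` forward in time, every point of
`supp μ¹` crosses `ω` backward in time. -/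
def GeometricCondition (v : State d → State d) (ω : Set (State d))
    (μ₀ μ₁ : Measure (State d)) : Prop :=
  (∀ x ∈ μ₀.support, ∃ t : ℝ, 0 < t ∧ flow v t x ∈ ω) ∧
    ∀ x ∈ μ₁.support, ∃ t : ℝ, 0 < t ∧ flow v (-t) x ∈ ω

/-- The measure `∑ᵢ c δ_{xᵢ}`. -/
def atomicMeasure (c : ℝ) (X : Fin n → State d) : Measure (State d) :=
  ∑ i, ENNReal.ofReal c • Measure.dirac (X i)

/-! ### Admissible controls and steering -/

/-- The localized control `𝟙_ω u`; `u` takes the time first and the point second. -/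
def localized (ω : Set (State d)) (u : ℝ → State d → State d) (t : ℝ) (x : State d) : State d :=
  ω.indicator (u t) x

/-- The Carathéodory condition for `𝟙_ω u`: Lipschitz in `x` (with a constant independent of `t`),
measurable in `t`, bounded. -/
def Admissible (ω : Set (State d)) (u : ℝ → State d → State d) : Prop :=
  (∃ L : ℝ≥0, ∀ t, LipschitzWith L (localized ω u t)) ∧
    (∀ x, Measurable fun t => localized ω u t x) ∧
    ∃ M : ℝ, ∀ t x, ‖localized ω u t x‖ ≤ M

/-- `x` solves `ẋ(t) = v(x(t)) + 𝟙_ω(x(t)) u(x(t), t)` for almost every `t ≥ 0`, with `x(0) = x₀`, in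
the sense of Carathéodory (integrated form). -/
def IsTrajectory (v : State d → State d) (ω : Set (State d)) (u : ℝ → State d → State d)
    (x₀ : State d) (x : ℝ → State d) : Prop :=
  ContinuousOn x (Set.Ici 0) ∧
    ∀ t, 0 ≤ t → x t = x₀ + ∫ s in (0 : ℝ)..t, (v (x s) + localized ω u s (x s))

/-- `R = ⌊n ε / γ⌋`, the number of agents that need not be steered. -/
def leftover (n : ℕ) (ε γ : ℝ) : ℕ := ⌊(n : ℝ) * ε / γ⌋₊

/-- Some admissible control, acting on all agents of `X⁰`, brings the agent `σ₀(i)` exactly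
to the target `x¹_{σ₁(i)}` at time `T`, for each of the first `n - R` indices `i`. -/
def SteersVia (v : State d → State d) (ω : Set (State d)) (X₀ X₁ : Fin n → State d)
    (R : ℕ) (T : ℝ) (σ₀ σ₁ : Equiv.Perm (Fin n)) : Prop :=
  ∃ u : ℝ → State d → State d, Admissible ω u ∧
    ∃ x : Fin n → ℝ → State d, (∀ i, IsTrajectory v ω u (X₀ i) (x i)) ∧
      ∀ i : Fin n, (i : ℕ) < n - R → x (σ₀ i) T = X₁ (σ₁ i)

/-- `X⁰` can be exactly steered to `X¹` at time `T` up to a mass `ε`, for a total mass `γ`. -/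
def SteerableUpTo (v : State d → State d) (ω : Set (State d)) (X₀ X₁ : Fin n → State d)
    (ε γ T : ℝ) : Prop :=
  ∃ σ₀ σ₁ : Equiv.Perm (Fin n), SteersVia v ω X₀ X₁ (leftover n ε γ) T σ₀ σ₁

/-! ### The infimum times -/

/-- `M*_e(X⁰, X¹) = max {t⁰(x⁰ᵢ), t¹(x¹ᵢ) : 1 ≤ i ≤ n}`. -/
def maxEntrance (v : State d → State d) (ω : Set (State d)) (X₀ X₁ : Fin n → State d) : ℝ :=
  ⨆ i, max (entranceTime v ω (X₀ i)) (backwardEntranceTime v ω (X₁ i))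

/-- The infimum of the times `T > M*_e(X⁰, X¹)` at which `X⁰` can be exactly steered to `X¹` up to a
mass `ε`, for a total mass `γ`. -/
def infTimeAll (v : State d → State d) (ω : Set (State d)) (X₀ X₁ : Fin n → State d)
    (ε γ : ℝ) : ℝ :=
  sInf {T : ℝ | maxEntrance v ω X₀ X₁ < T ∧ SteerableUpTo v ω X₀ X₁ ε γ T}

/-- The same infimum, where `T` only has to exceed the entrance times `t⁰(x⁰_{σ₀(i)})` and
`t¹(x¹_{σ₁(i)})` of the agents that are steered and of their targets. -/
def infTime (v : State d → State d) (ω : Set (State d)) (X₀ X₁ : Fin n → State d)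
    (ε γ : ℝ) : ℝ :=
  sInf {T : ℝ | ∃ σ₀ σ₁ : Equiv.Perm (Fin n),
    (∀ i : Fin n, (i : ℕ) < n - leftover n ε γ →
      entranceTime v ω (X₀ (σ₀ i)) < T ∧ backwardEntranceTime v ω (X₁ (σ₁ i)) < T) ∧
    SteersVia v ω X₀ X₁ (leftover n ε γ) T σ₀ σ₁}

/-- `M_{e,ε}(X⁰, X¹, γ) = max_{1 ≤ i ≤ n - R} (t⁰(x⁰ᵢ) + t¹(x¹_{i+R}))`. -/
def maxSum (v : State d → State d) (ω : Set (State d)) (X₀ X₁ : Fin n → State d)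
    (ε γ : ℝ) : ℝ :=
  ⨆ i : Fin (n - leftover n ε γ),
    (entranceTime v ω (X₀ ⟨i, by omega⟩) +
      backwardEntranceTime v ω (X₁ ⟨i + leftover n ε γ, by omega⟩))

/-! ### The quantity `S_ε` for measures -/

/-- `F_μ(t) = μ {x ∈ supp μ : t⁰(x) ≤ t}`. -/
def forwardMass (v : State d → State d) (ω : Set (State d)) (μ : Measure (State d)) (t : ℝ) : ℝ :=
  μ.real {x | x ∈ μ.support ∧ entranceTime v ω x ≤ t}

/-- `B_μ(t) = μ {x ∈ supp μ : t¹(x) ≤ t}`. -/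
def backwardMass (v : State d → State d) (ω : Set (State d)) (μ : Measure (State d)) (t : ℝ) : ℝ :=
  μ.real {x | x ∈ μ.support ∧ backwardEntranceTime v ω x ≤ t}

/-- The generalized inverse `G⁻¹(m) = inf {t ≥ 0 : G(t) ≥ m}`. -/
def genInv (G : ℝ → ℝ) (m : ℝ) : ℝ := sInf {t : ℝ | 0 ≤ t ∧ m ≤ G t}

/-- The set `{F_{μ⁰}⁻¹(m) + B_{μ¹}⁻¹(γ - ε - m) : m ∈ [0, γ - ε]}`, where `γ = μ⁰(ℝᵈ)`. -/
def sumSet (v : State d → State d) (ω : Set (State d)) (μ₀ μ₁ : Measure (State d))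
    (ε : ℝ) : Set ℝ :=
  (fun m => genInv (forwardMass v ω μ₀) m +
      genInv (backwardMass v ω μ₁) (μ₀.real Set.univ - ε - m)) ''
    Set.Icc 0 (μ₀.real Set.univ - ε)

/-- `S_ε(μ⁰, μ¹)`, the supremum of the set above. -/
def supSum (v : State d → State d) (ω : Set (State d)) (μ₀ μ₁ : Measure (State d)) (ε : ℝ) : ℝ :=
  sSup (sumSet v ω μ₀ μ₁ ε)

end

end CrowdControl

/-! Necessity. The control is Lipschitz in `x` and vanishes off `ω`, so by Grönwall's lemma an agent
follows its free orbit up to time `t⁰`, and the orbit arriving at its target from time `T - t¹` on.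
If `t⁰ + t¹ ≥ T`, the two stretches overlap and the whole motion is one free orbit. With `T > t⁰`
that orbit visits the open set `ω` at some time strictly between `t⁰` and `T`, so `t⁰ + t¹ < T`
after all. Hence every steered pair has sum less than `T` (`IsTrajectory.entranceTime_add_lt`). Let
the index `k` realize `M`. By pigeonhole, some steered pair joins an agent of index at least `k` to
a target of index at most `k + R`; its sum is at least `M`, so `M < T`.

Sufficiency. For `T > M`, pairing agent `i` with target `i + R` makes all sums less than `T`, which
leaves each pair a time interval `[s, s']` inside `ω`. It suffices to find pairwise disjoint `C¹`
curves that are free orbits outside these intervals and lie in `ω` during them: a sum of tent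
functions centred on the curves, weighted by the velocity corrections, is then an admissible control
(`exists_admissible_of_curves`).

Disjointness depends on the dimension. If `d ≥ 2`, each curve is perturbed during its control phase
by a vector outside a set of Hausdorff dimension at most one. If `d = 1`, curves cannot pass each
other, so agents and targets are matched again by position; this keeps all sums below `T`
(`entranceTime_add_lt_of_sorted`). An ordered family is obtained from local ones by a partition of
unity, because the ordering constraints are convex (`exists_strictMono_switch`).

The identity with `S_ε` holds because `F` and `B` are staircases whose generalized inverses run
through the sorted entrance times (`sumSet_isLUB`). -/

namespace CrowdControl

/-! ### Global solutions and integral Grönwall inequalities. -/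

section ODE

variable {E : Type*} [NormedAddCommGroup E] [NormedSpace ℝ E]

/-- Global existence for a field that is continuous in time, globally Lipschitz in space and
bounded. -/
theorem exists_isIntegralCurve [CompleteSpace E] {w : ℝ → E → E} {K : ℝ≥0} {M : ℝ}
    (hw : ∀ t, LipschitzWith K (w t)) (hc : ∀ x, Continuous fun t => w t x)
    (hM : ∀ t x, ‖w t x‖ ≤ M) (x₀ : E) :
    ∃ γ : ℝ → E, γ 0 = x₀ ∧ IsIntegralCurve γ w := by
  have hM0 : 0 ≤ M := (norm_nonneg _).trans (hM 0 0)
  have hloc : ∀ k : ℕ, ∃ γ : ℝ → E, γ 0 = x₀ ∧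
      ∀ t ∈ Set.Icc (-(k : ℝ)) k, HasDerivWithinAt γ (w t (γ t)) (Set.Icc (-(k : ℝ)) k) t := by
    intro k
    have hk : (0 : ℝ) ∈ Set.Icc (-(k : ℝ)) k := ⟨by simp, by simp⟩
    -- The speed is at most `M`, so the ball of radius `M * k` is not left during `[-k, k]` and no
    -- smallness of the interval is required.
    have hP : IsPicardLindelof w (tmin := -(k : ℝ)) (tmax := k) ⟨0, hk⟩ x₀
        (⟨M, hM0⟩ * k) 0 ⟨M, hM0⟩ K := by
      refine ⟨fun t _ => (hw t).lipschitzOnWith, fun x _ => (hc x).continuousOn,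
        fun t _ x _ => hM t x, ?_⟩
      simp only [sub_zero, zero_sub, neg_neg, max_self, NNReal.coe_zero]
      exact le_rfl
    simpa using hP.exists_eq_forall_mem_Icc_hasDerivWithinAt₀
  choose γ hγ0 hγ using hloc
  have hcont : ∀ k : ℕ, ContinuousOn (γ k) (Set.Icc (-(k : ℝ)) k) := fun k t ht =>
    (hγ k t ht).continuousWithinAt
  have hder : ∀ k : ℕ, ∀ t ∈ Set.Ioo (-(k : ℝ)) k, HasDerivAt (γ k) (w t (γ k t)) t :=
    fun k t ht => (hγ k t (Set.Ioo_subset_Icc_self ht)).hasDerivAt (Icc_mem_nhds ht.1 ht.2)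
  have hagree : ∀ k l : ℕ, k ≤ l → Set.EqOn (γ k) (γ l) (Set.Ioo (-(k : ℝ)) k) := by
    intro k l hkl t ht
    have hkl' : (k : ℝ) ≤ l := by exact_mod_cast hkl
    have hk0 : (0 : ℝ) < k := by
      have h1 := ht.1
      have h2 := ht.2
      linarith
    exact ODE_solution_unique_of_mem_Ioo (v := w) (s := fun _ => Set.univ) (K := K)
      (fun t _ => (hw t).lipschitzOnWith) (t₀ := 0) ⟨by linarith, hk0⟩
      (fun t ht => ⟨hder k t ht, trivial⟩)
      (fun t ht => ⟨hder l t ⟨by linarith [ht.1], by linarith [ht.2]⟩, trivial⟩)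
      ((hγ0 k).trans (hγ0 l).symm) ht
  -- The summand `1` makes `t` interior to `[-N t, N t]`, so the glued curve agrees near `t` with a
  -- single local solution.
  let N : ℝ → ℕ := fun t => ⌈|t|⌉₊ + 1
  have hN : ∀ t, |t| < N t := fun t => by
    have := Nat.le_ceil |t|
    simp only [N]
    push_cast
    linarith
  refine ⟨fun t => γ (N t) t, hγ0 _, fun t => ?_⟩
  have hmem : t ∈ Set.Ioo (-(N t : ℝ)) (N t) := abs_lt.1 (hN t)
  have heq : (fun s => γ (N s) s) =ᶠ[nhds t] γ (N t) := by
    filter_upwards [Ioo_mem_nhds hmem.1 hmem.2] with s hs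
    rcases le_total (N s) (N t) with h | h
    · exact hagree _ _ h (abs_lt.1 (hN s))
    · exact (hagree _ _ h hs).symm
  exact (hder _ t hmem).congr_of_eventuallyEq heq

/-- Integral form of Grönwall's lemma with zero initial value. -/
theorem eq_zero_of_le_integral {e : ℝ → ℝ} (he : Continuous e) (h0 : ∀ t, 0 ≤ e t) {K a b : ℝ}
    (h : ∀ t ∈ Set.Icc a b, e t ≤ K * ∫ s in a..t, e s) : ∀ t ∈ Set.Icc a b, e t = 0 := by
  have hd : ∀ t, HasDerivAt (fun t => ∫ s in a..t, e s) (e t) t := fun t =>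
    intervalIntegral.integral_hasDerivAt_right (he.intervalIntegrable _ _)
      (he.stronglyMeasurableAtFilter _ _) he.continuousAt
  have hE := eq_zero_of_abs_deriv_le_mul_abs_self_of_eq_zero_right (K := K) (a := a) (b := b)
    (fun t _ => (hd t).continuousAt.continuousWithinAt) (fun t _ => (hd t).hasDerivWithinAt)
    (by simp) (fun t ht => by
      have hpos : 0 ≤ ∫ s in a..t, e s := intervalIntegral.integral_nonneg ht.1 fun s _ => h0 s
      rw [Real.norm_of_nonneg (h0 t), Real.norm_of_nonneg hpos]
      exact h t (Set.Ico_subset_Icc_self ht))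
  intro t ht
  have h1 := h t ht
  rw [hE t ht, mul_zero] at h1
  exact le_antisymm h1 (h0 t)

/-- Time reversal, for trajectories known at their final time. -/
theorem eq_zero_of_le_integral_left {e : ℝ → ℝ} (he : Continuous e) (h0 : ∀ t, 0 ≤ e t)
    {K a b : ℝ} (h : ∀ t ∈ Set.Icc a b, e t ≤ K * ∫ s in t..b, e s) :
    ∀ t ∈ Set.Icc a b, e t = 0 := by
  intro t ht
  have := eq_zero_of_le_integral (e := fun s => e (-s)) (he.comp continuous_neg) (fun s => h0 _)
    (K := K) (a := -b) (b := -a) (fun s hs => by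
      have h1 := h (-s) ⟨by linarith [hs.2], by linarith [hs.1]⟩
      rwa [intervalIntegral.integral_comp_neg, neg_neg]) (-t) ⟨by linarith [ht.2], by linarith [ht.1]⟩
  simpa using this

end ODE

/-! ### The free flow and its hitting times. -/

section Flow

variable {d n : ℕ} {v : State d → State d} {ω : Set (State d)}

/-- Shows that the default branch in `flow` is never taken for bounded Lipschitz fields. -/
theorem flow_spec (hvLip : ∃ L : ℝ≥0, LipschitzWith L v) (hvBdd : ∃ M : ℝ, ∀ x, ‖v x‖ ≤ M)
    (x : State d) :
    flow v 0 x = x ∧ ∀ t, HasDerivAt (fun t => flow v t x) (v (flow v t x)) t := by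
  obtain ⟨L, hL⟩ := hvLip
  obtain ⟨M, hM⟩ := hvBdd
  have h : ∃ γ : ℝ → State d, γ 0 = x ∧ IsIntegralCurve γ (fun _ => v) :=
    exists_isIntegralCurve (w := fun _ => v) (fun _ => hL) (fun _ => continuous_const)
      (fun _ => hM) x
  have h1 : ∀ t, flow v t x = h.choose t := fun t => by rw [flow, dif_pos h]
  refine ⟨(h1 0).trans h.choose_spec.1, fun t => ?_⟩
  have h2 := h.choose_spec.2 t
  rw [h1 t]
  exact h2.congr_of_eventuallyEq (Filter.Eventually.of_forall h1)

/-- The bounded Lipschitz fields, whose flow is global. -/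
structure GoodField (v : State d → State d) : Prop where
  lip : ∃ L : ℝ≥0, LipschitzWith L v
  bdd : ∃ M : ℝ, ∀ x, ‖v x‖ ≤ M

namespace GoodField

variable (hv : GoodField v)
include hv

theorem flow_zero (x : State d) : flow v 0 x = x := (flow_spec hv.lip hv.bdd x).1

theorem hasDerivAt_flow (x : State d) (t : ℝ) :
    HasDerivAt (fun t => flow v t x) (v (flow v t x)) t := (flow_spec hv.lip hv.bdd x).2 t

theorem continuous_flow (x : State d) : Continuous fun t => flow v t x :=
  continuous_iff_continuousAt.2 fun t => (hv.hasDerivAt_flow x t).continuousAt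

theorem continuous : Continuous v := by
  obtain ⟨L, hL⟩ := hv.lip
  exact hL.continuous

theorem eq_flow {γ : ℝ → State d} (hγ : ∀ t, HasDerivAt γ (v (γ t)) t) {a : ℝ} {x : State d}
    (hx : γ a = flow v a x) (t : ℝ) : γ t = flow v t x := by
  obtain ⟨L, hL⟩ := hv.lip
  exact congrFun (ODE_solution_unique_univ (v := fun _ => v) (s := fun _ => Set.univ) (K := L)
    (fun _ => hL.lipschitzOnWith) (fun t => ⟨hγ t, trivial⟩)
    (fun t => ⟨hv.hasDerivAt_flow x t, trivial⟩) hx) t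

theorem hasDerivAt_flow_add (x : State d) (s t : ℝ) :
    HasDerivAt (fun t => flow v (t + s) x) (v (flow v (t + s) x)) t :=
  (hv.hasDerivAt_flow x (t + s)).comp_add_const t s

theorem flow_flow (s t : ℝ) (x : State d) : flow v t (flow v s x) = flow v (t + s) x :=
  (hv.eq_flow (a := 0) (hv.hasDerivAt_flow_add x s) (by simp [hv.flow_zero]) t).symm

theorem flow_injective (t : ℝ) : Function.Injective (flow v t) := fun x y h => by
  have h1 : flow v (-t) (flow v t x) = flow v (-t) (flow v t y) := by rw [h]
  simpa [hv.flow_flow, hv.flow_zero] using h1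

theorem contDiff_flow (x : State d) : ContDiff ℝ 1 fun t => flow v t x := by
  rw [contDiff_one_iff_deriv]
  refine ⟨fun t => (hv.hasDerivAt_flow x t).differentiableAt, ?_⟩
  have : deriv (fun t => flow v t x) = fun t => v (flow v t x) :=
    funext fun t => (hv.hasDerivAt_flow x t).deriv
  rw [this]
  exact hv.continuous.comp (hv.continuous_flow x)

end GoodField

/-! ### Hitting times -/

section Hitting

variable {c : ℝ → State d}

theorem sInf_hitting_nonneg (c : ℝ → State d) (ω : Set (State d)) :
    0 ≤ sInf {t : ℝ | 0 ≤ t ∧ c t ∈ ω} := Real.sInf_nonneg fun _ ht => ht.1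

theorem sInf_hitting_le {t : ℝ} (h0 : 0 ≤ t) (ht : c t ∈ ω) :
    sInf {t : ℝ | 0 ≤ t ∧ c t ∈ ω} ≤ t := 
  csInf_le (s := {t : ℝ | 0 ≤ t ∧ c t ∈ ω}) ⟨0, fun _ hs => hs.1⟩ (And.intro h0 ht)

/-- The infimum itself is a poor switching time: for a point outside `ω` it is not attained, `ω`
being open. Times slightly larger, at which the curve is inside `ω`, are what both directions of the
theorem use. -/
theorem exists_mem_of_sInf_hitting_lt (hc : Continuous c) (hω : IsOpen ω)
    (hex : ∃ t : ℝ, 0 < t ∧ c t ∈ ω) {b : ℝ} (hb : sInf {t : ℝ | 0 ≤ t ∧ c t ∈ ω} < b) :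
    ∃ s, sInf {t : ℝ | 0 ≤ t ∧ c t ∈ ω} < s ∧ s < b ∧ c s ∈ ω := by
  obtain ⟨t, ht0, ht⟩ := hex
  have hne : {t : ℝ | 0 ≤ t ∧ c t ∈ ω}.Nonempty := ⟨t, ht0.le, ht⟩
  obtain ⟨s, ⟨hs0, hs⟩, hsb⟩ := exists_lt_of_csInf_lt hne hb
  have hU : {r | r < b ∧ c r ∈ ω} ∈ nhds s :=
    Filter.inter_mem (Iio_mem_nhds hsb) (hc.continuousAt.preimage_mem_nhds (hω.mem_nhds hs))
  obtain ⟨δ, hδ, hball⟩ := Metric.mem_nhds_iff.1 hU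
  -- Moving past `s` gives strict inequality even if `s` is the infimum, as for a point starting in
  -- `ω`.
  have hm : s + δ / 2 ∈ Metric.ball s δ := by
    rw [Metric.mem_ball, Real.dist_eq, add_sub_cancel_left, abs_of_pos (by linarith)]
    linarith
  have := hball hm
  exact ⟨s + δ / 2, by linarith [sInf_hitting_le hs0 hs], this.1, this.2⟩

end Hitting

theorem entranceTime_nonneg (x : State d) : 0 ≤ entranceTime v ω x := sInf_hitting_nonneg _ _

theorem backwardEntranceTime_nonneg (x : State d) : 0 ≤ backwardEntranceTime v ω x :=
  sInf_hitting_nonneg (fun t => flow v (-t) x) ω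

theorem entranceTime_le {x : State d} {t : ℝ} (h0 : 0 ≤ t) (ht : flow v t x ∈ ω) :
    entranceTime v ω x ≤ t := sInf_hitting_le (c := fun t => flow v t x) h0 ht

theorem backwardEntranceTime_le {x : State d} {t : ℝ} (h0 : 0 ≤ t) (ht : flow v (-t) x ∈ ω) :
    backwardEntranceTime v ω x ≤ t := sInf_hitting_le (c := fun t => flow v (-t) x) h0 ht

theorem exists_flow_mem (hv : GoodField v) (hω : IsOpen ω) {x : State d}
    (hex : ∃ t : ℝ, 0 < t ∧ flow v t x ∈ ω) {b : ℝ} (hb : entranceTime v ω x < b) :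
    ∃ s, entranceTime v ω x < s ∧ s < b ∧ flow v s x ∈ ω :=
  exists_mem_of_sInf_hitting_lt (hv.continuous_flow x) hω hex hb

theorem exists_flow_neg_mem (hv : GoodField v) (hω : IsOpen ω) {x : State d}
    (hex : ∃ t : ℝ, 0 < t ∧ flow v (-t) x ∈ ω) {b : ℝ} (hb : backwardEntranceTime v ω x < b) :
    ∃ s, backwardEntranceTime v ω x < s ∧ s < b ∧ flow v (-s) x ∈ ω :=
  exists_mem_of_sInf_hitting_lt (c := fun t => flow v (-t) x)
    ((hv.continuous_flow x).comp continuous_neg) hω hex hb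

/-- An uncontrolled orbit that joins two points crosses the control region in between. -/
theorem entranceTime_add_lt_of_flow_eq (hv : GoodField v) (hω : IsOpen ω) {x y : State d}
    (hex : ∃ t : ℝ, 0 < t ∧ flow v t x ∈ ω) {T : ℝ} (hxy : flow v T x = y)
    (hT : entranceTime v ω x < T) :
    entranceTime v ω x + backwardEntranceTime v ω y < T := by
  obtain ⟨s, hs, hsT, hmem⟩ := exists_flow_mem hv hω hex hT
  have : backwardEntranceTime v ω y ≤ T - s := by
    refine backwardEntranceTime_le (by linarith) ?_
    rw [← hxy, hv.flow_flow]
    simpa using hmem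
  linarith

end Flow

/-! ### Controlled trajectories outside the control region. -/

section Trajectories

variable {d n : ℕ} {v : State d → State d} {ω : Set (State d)} {u : ℝ → State d → State d}
  {x₀ : State d} {x : ℝ → State d}

/-- Comparison of a controlled trajectory with an uncontrolled orbit `z` on which the control
vanishes. -/
theorem IsTrajectory.dist_integral_le (hv : GoodField v) (hu : Admissible ω u)
    (hx : IsTrajectory v ω u x₀ x) {z : ℝ → State d} (hz : ∀ t, HasDerivAt z (v (z t)) t) :
    ∃ K : ℝ, ∀ a b, 0 ≤ a → a ≤ b → (∀ t ∈ Set.Ioo a b, z t ∉ ω) →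
      ‖(x b - z b) - (x a - z a)‖ ≤ K * ∫ s in a..b, ‖x (max s 0) - z s‖ := by
  obtain ⟨L, hL⟩ := hv.lip
  obtain ⟨⟨L', hL'⟩, hmeas, M, hM⟩ := hu
  obtain ⟨M', hM'⟩ := hv.bdd
  have hzc : Continuous z := continuous_iff_continuousAt.2 fun t => (hz t).continuousAt
  -- A trajectory is continuous only on `[0, ∞)`; freezing it at negative times gives a globally
  -- continuous function.
  have hxc : Continuous fun s => x (max s 0) :=
    hx.1.comp_continuous (by fun_prop) fun s => le_max_right s 0
  set w : ℝ → State d := fun s => v (x (max s 0)) + localized ω u s (x (max s 0)) with hw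
  have hwm : Measurable w := by
    refine (hv.continuous.comp hxc).measurable.add ?_
    have h1 : Measurable (Function.uncurry fun (y : State d) (t : ℝ) => localized ω u t y) :=
      (stronglyMeasurable_uncurry_of_continuous_of_stronglyMeasurable
        (fun t => (hL' t).continuous) (fun y => (hmeas y).stronglyMeasurable)).measurable
    exact h1.comp (hxc.measurable.prodMk measurable_id)
  have hwi : ∀ a b, IntervalIntegrable w volume a b := fun a b =>
    (intervalIntegrable_const (c := M' + M)).mono_fun' hwm.aestronglyMeasurable
      (Filter.Eventually.of_forall fun s => (norm_add_le _ _).trans (add_le_add (hM' _) (hM _ _)))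
  have hxw : ∀ t, 0 ≤ t → x t = x₀ + ∫ s in (0 : ℝ)..t, w s := fun t ht => by
    rw [hx.2 t ht]
    congr 1
    refine intervalIntegral.integral_congr fun s hs => ?_
    rw [Set.uIcc_of_le ht] at hs
    simp only [hw, max_eq_left hs.1]
  have hvz : Continuous fun s => v (z s) := hv.continuous.comp hzc
  refine ⟨(L : ℝ) + L', fun a b ha hab hout => ?_⟩
  have hxab : x b - x a = ∫ s in a..b, w s := by
    rw [hxw a ha, hxw b (ha.trans hab), add_sub_add_left_eq_sub,
      intervalIntegral.integral_interval_sub_left (hwi _ _) (hwi _ _)]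
  have hzab : z b - z a = ∫ s in a..b, v (z s) :=
    (intervalIntegral.integral_eq_sub_of_hasDerivAt (fun t _ => hz t)
      (hvz.intervalIntegrable _ _)).symm
  have hsub : (x b - z b) - (x a - z a) = ∫ s in a..b, (w s - v (z s)) := by
    rw [intervalIntegral.integral_sub (hwi _ _) (hvz.intervalIntegrable _ _), ← hxab, ← hzab]
    abel
  have hdc : Continuous fun s => ‖x (max s 0) - z s‖ := (hxc.sub hzc).norm
  rw [hsub, ← intervalIntegral.integral_const_mul]
  refine (intervalIntegral.norm_integral_le_integral_norm hab).trans ?_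
  refine intervalIntegral.integral_mono_on_of_le_Ioo hab
    ((hwi _ _).sub (hvz.intervalIntegrable _ _)).norm
    ((continuous_const.mul hdc).intervalIntegrable _ _) fun s hs => ?_
  -- Since the control vanishes at `z s`, its value at `x s` is a difference and is bounded by `L' *
  -- ‖x s - z s‖`; whether `x` itself enters `ω` does not matter.
  have h0 : localized ω u s (z s) = 0 := Set.indicator_of_notMem (hout s hs) _
  have h1 : w s - v (z s) = (v (x (max s 0)) - v (z s)) +
      (localized ω u s (x (max s 0)) - localized ω u s (z s)) := by
    rw [h0, sub_zero]
    exact add_sub_right_comm _ _ _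
  rw [h1, add_mul]
  exact (norm_add_le _ _).trans (add_le_add (hL.norm_sub_le _ _) ((hL' s).norm_sub_le _ _))

/-- Grönwall's lemma for the preceding comparison, run forward from `a` or backward from `b`. -/
theorem IsTrajectory.eq_of_forall_notMem (hv : GoodField v) (hu : Admissible ω u)
    (hx : IsTrajectory v ω u x₀ x) {z : ℝ → State d} (hz : ∀ t, HasDerivAt z (v (z t)) t)
    {a b : ℝ} (ha : 0 ≤ a) (hout : ∀ t ∈ Set.Ioo a b, z t ∉ ω) (h : x a = z a ∨ x b = z b) :
    ∀ t ∈ Set.Icc a b, x t = z t := by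
  obtain ⟨K, hK⟩ := hx.dist_integral_le hv hu hz
  have hzc : Continuous z := continuous_iff_continuousAt.2 fun t => (hz t).continuousAt
  have hxc : Continuous fun s => x (max s 0) :=
    hx.1.comp_continuous (by fun_prop) fun s => le_max_right s 0
  have hdc : Continuous fun s => ‖x (max s 0) - z s‖ := (hxc.sub hzc).norm
  have key : ∀ t ∈ Set.Icc a b, ‖x (max t 0) - z t‖ = 0 := by
    rcases h with h | h
    · refine eq_zero_of_le_integral hdc (fun _ => norm_nonneg _) (K := K) fun t ht => ?_
      have := hK a t ha ht.1 fun s hs => hout s ⟨hs.1, hs.2.trans_le ht.2⟩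
      rw [h, sub_self, sub_zero] at this
      rwa [max_eq_left (ha.trans ht.1)]
    · refine eq_zero_of_le_integral_left hdc (fun _ => norm_nonneg _) (K := K) fun t ht => ?_
      have := hK t b (ha.trans ht.1) ht.2 fun s hs => hout s ⟨ht.1.trans_lt hs.1, hs.2⟩
      rw [h, sub_self, zero_sub, norm_neg] at this
      rwa [max_eq_left (ha.trans ht.1)]
  intro t ht
  have := key t ht
  rw [max_eq_left (ha.trans ht.1)] at this
  exact sub_eq_zero.1 (norm_eq_zero.1 this)

/-- A steered agent spends positive time in the control region. -/
theorem IsTrajectory.entranceTime_add_lt (hv : GoodField v) (hω : IsOpen ω)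
    (hu : Admissible ω u) (hx : IsTrajectory v ω u x₀ x)
    (hex : ∃ t : ℝ, 0 < t ∧ flow v t x₀ ∈ ω) {T : ℝ} (h0 : entranceTime v ω x₀ < T)
    (h1 : backwardEntranceTime v ω (x T) < T) :
    entranceTime v ω x₀ + backwardEntranceTime v ω (x T) < T := by
  by_contra! hT
  set a := entranceTime v ω x₀ with ha
  set b := T - backwardEntranceTime v ω (x T) with hb
  have ha0 : 0 ≤ a := entranceTime_nonneg _
  have hb0 : 0 ≤ b := by linarith
  have hbT : b ≤ T := by linarith [backwardEntranceTime_nonneg (v := v) (ω := ω) (x T)]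
  have hx0 : x 0 = x₀ := by simpa using hx.2 0 le_rfl
  have hf : ∀ t ∈ Set.Icc 0 a, x t = flow v t x₀ :=
    hx.eq_of_forall_notMem hv hu (hv.hasDerivAt_flow x₀) le_rfl
      (fun t ht hmem => (entranceTime_le ht.1.le hmem).not_gt ht.2)
      (Or.inl (by rw [hx0, hv.flow_zero]))
  have hg : ∀ t ∈ Set.Icc b T, x t = flow v (t + -T) (x T) :=
    hx.eq_of_forall_notMem hv hu (hv.hasDerivAt_flow_add (x T) (-T)) hb0
      (fun t ht hmem => by
        have := backwardEntranceTime_le (v := v) (ω := ω) (x := x T) (t := T - t)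
          (by linarith [ht.2]) (by rwa [show -(T - t) = t + -T by ring])
        linarith [ht.1])
      (Or.inr (by rw [add_neg_cancel, hv.flow_zero]))
  have hba : b ≤ a := by linarith
  -- Both descriptions of `x` are valid at time `b ≤ a`, so the initial and the final orbit are the
  -- same.
  have hglue : flow v T x₀ = x T := by
    have h2 := (hf b ⟨hb0, hba⟩).symm.trans (hg b ⟨le_rfl, hbT⟩)
    have h3 := congrArg (flow v (T - b)) h2
    rw [hv.flow_flow, hv.flow_flow] at h3
    rwa [sub_add_cancel, show T - b + (b + -T) = 0 by ring, hv.flow_zero] at h3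
  have := entranceTime_add_lt_of_flow_eq hv hω hex hglue h0
  linarith

end Trajectories

/-! ### The pigeonhole argument for the lower bound. -/

section Counting

variable {d n : ℕ} {v : State d → State d} {ω : Set (State d)} {X₀ X₁ : Fin n → State d}

theorem leftover_lt {ε γ : ℝ} (hn : 0 < n) (hγ : 0 < γ) (hεγ : ε < γ) :
    leftover n ε γ < n := by
  rw [leftover, Nat.floor_lt' hn.ne', div_lt_iff₀ hγ]
  exact mul_lt_mul_of_pos_left hεγ (by exact_mod_cast hn)

/-- Among `n - R` pairs of a matching, one starts at index at least `k` and ends at index at most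
`k + R`. -/
theorem exists_le_and_le (σ₀ σ₁ : Equiv.Perm (Fin n)) {R k : ℕ} (hk : k + R < n) :
    ∃ i : Fin n, (i : ℕ) < n - R ∧ k ≤ (σ₀ i : ℕ) ∧ (σ₁ i : ℕ) ≤ k + R := by
  classical
  by_contra! h
  -- Otherwise each of the `n - R` indices has `σ₀ i < k` (at most `k` of them) or `σ₁ i > k + R`
  -- (at most `n - 1 - (k + R)`), which accounts for only `n - R - 1`.
  let A : Finset (Fin n) := {i | (i : ℕ) < n - R}
  let B : Finset (Fin n) := {i | (σ₀ i : ℕ) < k}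
  let C : Finset (Fin n) := {i | k + R < (σ₁ i : ℕ)}
  have hABC : A ⊆ B ∪ C := fun i hi => by
    simp only [A, B, C, Finset.mem_union, Finset.mem_filter, Finset.mem_univ, true_and] at hi ⊢
    by_contra! h2
    exact (h i hi h2.1).not_ge h2.2
  have hA : A.card = n - R := by
    have : A = Finset.univ.filter fun i : Fin n => (i : ℕ) < n - R := rfl
    rw [this, Fin.card_filter_val_lt]
    omega
  have hB : B.card ≤ k := by
    have : B.card ≤ (Finset.range k).card := by
      refine Finset.card_le_card_of_injOn (fun i => (σ₀ i : ℕ)) (fun i hi => ?_) fun i _ j _ hij =>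
        σ₀.injective (Fin.ext hij)
      simpa [B] using hi
    simpa using this
  have hC : C.card ≤ n - 1 - (k + R) := by
    have : C.card ≤ (Finset.Ioo (k + R) n).card := by
      refine Finset.card_le_card_of_injOn (fun i => (σ₁ i : ℕ)) (fun i hi => ?_) fun i _ j _ hij =>
        σ₁.injective (Fin.ext hij)
      simpa [C] using hi
    rw [Nat.card_Ioo] at this
    omega
  have := (Finset.card_le_card hABC).trans (Finset.card_union_le _ _)
  omega

/-- Steering with `T` beyond the entrance times of the steered agents takes longer than
`maxSum`. -/
theorem SteersVia.maxSum_lt (hn : 0 < n) (hv : GoodField v) (hω : IsOpen ω)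
    (hex : ∀ i, ∃ t : ℝ, 0 < t ∧ flow v t (X₀ i) ∈ ω)
    (hsort₀ : Monotone fun i => entranceTime v ω (X₀ i))
    (hsort₁ : Antitone fun i => backwardEntranceTime v ω (X₁ i))
    {γ ε : ℝ} (hγ : 0 < γ) (hεγ : ε < γ) {T : ℝ} {σ₀ σ₁ : Equiv.Perm (Fin n)}
    (hT : ∀ i : Fin n, (i : ℕ) < n - leftover n ε γ →
      entranceTime v ω (X₀ (σ₀ i)) < T ∧ backwardEntranceTime v ω (X₁ (σ₁ i)) < T)
    (h : SteersVia v ω X₀ X₁ (leftover n ε γ) T σ₀ σ₁) : maxSum v ω X₀ X₁ ε γ < T := by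
  obtain ⟨u, hu, x, hx, hxT⟩ := h
  have hR := leftover_lt hn hγ hεγ
  have : Nonempty (Fin (n - leftover n ε γ)) := ⟨⟨0, by omega⟩⟩
  obtain ⟨k, hk⟩ := exists_eq_ciSup_of_finite (f := fun i : Fin (n - leftover n ε γ) =>
    (entranceTime v ω (X₀ ⟨i, by omega⟩) +
      backwardEntranceTime v ω (X₁ ⟨i + leftover n ε γ, by omega⟩)))
  rw [maxSum, ← hk]
  obtain ⟨i, hi, h0, h1⟩ := exists_le_and_le σ₀ σ₁ (R := leftover n ε γ) (k := k) (by omega)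
  have hi' := (hx (σ₀ i)).entranceTime_add_lt hv hω hu (hex _) (hT i hi).1
    (by rw [hxT i hi]; exact (hT i hi).2)
  rw [hxT i hi] at hi'
  have h2 := hsort₀ (show (⟨k, by omega⟩ : Fin n) ≤ σ₀ i from h0)
  have h3 := hsort₁ (show σ₁ i ≤ (⟨k + leftover n ε γ, by omega⟩ : Fin n) from h1)
  simp only at h2 h3
  linarith

end Counting

/-! ### Atomic measures and their mass functions. -/

section Measures

variable {d n : ℕ} {v : State d → State d} {ω : Set (State d)}

theorem atomicMeasure_real {c : ℝ} (hc : 0 ≤ c) (X : Fin n → State d) (S : Set (State d))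
    [DecidablePred fun i => X i ∈ S] :
    (atomicMeasure c X).real S = c * (Finset.univ.filter fun i => X i ∈ S).card := by
  rw [Measure.real, atomicMeasure, Measure.finsetSum_apply, ENNReal.toReal_sum]
  · rw [Finset.card_filter, Nat.cast_sum, Finset.mul_sum]
    refine Finset.sum_congr rfl fun i _ => ?_
    rw [Measure.smul_apply, Measure.dirac_apply, smul_eq_mul, ENNReal.toReal_mul,
      ENNReal.toReal_ofReal hc]
    by_cases h : X i ∈ S <;> simp [h]
  · intro i _
    rw [Measure.smul_apply, smul_eq_mul]
    exact ENNReal.mul_ne_top ENNReal.ofReal_ne_top (measure_ne_top _ _)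

theorem mem_support_atomicMeasure {c : ℝ} (hc : 0 < c) (X : Fin n → State d) (i : Fin n) :
    X i ∈ (atomicMeasure c X).support := by
  rw [Measure.mem_support_iff_forall]
  intro U hU
  rw [atomicMeasure, Measure.finsetSum_apply]
  refine lt_of_lt_of_le ?_ (Finset.single_le_sum (fun _ _ => zero_le) (Finset.mem_univ i))
  rw [Measure.smul_apply, Measure.dirac_apply_of_mem (mem_of_mem_nhds hU)]
  simpa using hc

theorem forwardMass_atomicMeasure {c : ℝ} (hc : 0 < c) (X : Fin n → State d) (t : ℝ) :
    forwardMass v ω (atomicMeasure c X) t =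
      c * (Finset.univ.filter fun i => entranceTime v ω (X i) ≤ t).card := by
  classical
  rw [forwardMass, atomicMeasure_real hc.le]
  simp [mem_support_atomicMeasure hc]

theorem backwardMass_atomicMeasure {c : ℝ} (hc : 0 < c) (X : Fin n → State d) (t : ℝ) :
    backwardMass v ω (atomicMeasure c X) t =
      c * (Finset.univ.filter fun i => backwardEntranceTime v ω (X i) ≤ t).card := by
  classical
  rw [backwardMass, atomicMeasure_real hc.le]
  simp [mem_support_atomicMeasure hc]

end Measures

/-! ### Generalized inverses of staircase functions. -/

section GenInv

variable {n : ℕ} {c : ℝ} {a : Fin n → ℝ} {G : ℝ → ℝ}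

theorem bddBelow_genInv (G : ℝ → ℝ) (m : ℝ) : BddBelow {t : ℝ | 0 ≤ t ∧ m ≤ G t} :=
  ⟨0, fun _ ht => ht.1⟩

/-- Only an inequality, because later indices may share the value `a k`. -/
theorem mul_le_count (hc : 0 < c) (ha : Monotone a)
    (hG : ∀ t, G t = c * (Finset.univ.filter fun i => a i ≤ t).card) (k : Fin n) :
    c * (k + 1) ≤ G (a k) := by
  rw [hG]
  refine mul_le_mul_of_nonneg_left ?_ hc.le
  have h : (Finset.Iic k).card ≤ (Finset.univ.filter fun i => a i ≤ a k).card :=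
    Finset.card_le_card fun i hi => by simpa using ha (Finset.mem_Iic.1 hi)
  rw [Fin.card_Iic] at h
  exact_mod_cast h

/-- Together with `le_genInv` this gives the inverse the value `a k` on `(c k, c (k + 1)]`. Ties in
`a` do no harm to either bound. -/
theorem genInv_le (hc : 0 < c) (ha : Monotone a) (ha0 : ∀ i, 0 ≤ a i)
    (hG : ∀ t, G t = c * (Finset.univ.filter fun i => a i ≤ t).card) {m : ℝ} {k : Fin n}
    (hm : m ≤ c * (k + 1)) : genInv G m ≤ a k :=
  csInf_le (bddBelow_genInv G m) (And.intro (ha0 k) (hm.trans (mul_le_count hc ha hG k)))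

theorem le_genInv (hc : 0 < c) (ha : Monotone a) (ha0 : ∀ i, 0 ≤ a i)
    (hG : ∀ t, G t = c * (Finset.univ.filter fun i => a i ≤ t).card) {m : ℝ} {k : Fin n}
    (hkm : c * k < m) (hmn : m ≤ c * n) : a k ≤ genInv G m := by
  have hn : 0 < n := k.pos
  -- The bound `m ≤ c * n` enters here: the real infimum of an empty set is `0`, which would break
  -- the estimate.
  have hne : {t : ℝ | 0 ≤ t ∧ m ≤ G t}.Nonempty := by
    refine ⟨a ⟨n - 1, by omega⟩, ha0 _, hmn.trans ?_⟩
    have := mul_le_count hc ha hG ⟨n - 1, by omega⟩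
    simp only at this
    rwa [Nat.cast_sub hn, Nat.cast_one, sub_add_cancel] at this
  refine le_csInf hne fun t ht => ?_
  by_contra! hlt
  have h : (Finset.univ.filter fun i => a i ≤ t).card ≤ (Finset.Iio k).card := by
    refine Finset.card_le_card fun i hi => Finset.mem_Iio.2 ?_
    by_contra! hki
    have h1 : a i ≤ t := by simpa using hi
    linarith [ha hki]
  rw [Fin.card_Iio] at h
  have h2 : G t ≤ c * k := by
    rw [hG]
    exact mul_le_mul_of_nonneg_left (by exact_mod_cast h) hc.le
  linarith [ht.2]

end GenInv

/-! ### The supremum `S_ε` for atomic measures. -/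

section SupSum

variable {d n : ℕ} {v : State d → State d} {ω : Set (State d)} {X₀ X₁ : Fin n → State d}
  {γ ε : ℝ}

theorem le_maxSum (k : ℕ) (hk : k < n - leftover n ε γ) :
    entranceTime v ω (X₀ ⟨k, by omega⟩) +
      backwardEntranceTime v ω (X₁ ⟨k + leftover n ε γ, by omega⟩) ≤ maxSum v ω X₀ X₁ ε γ :=
  le_ciSup (f := fun i : Fin (n - leftover n ε γ) =>
    (entranceTime v ω (X₀ ⟨i, by omega⟩) +
      backwardEntranceTime v ω (X₁ ⟨i + leftover n ε γ, by omega⟩))) (Set.finite_range _).bddAbove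
    ⟨k, hk⟩

/-- In units of the atom mass `c`, the two arguments add up to `n - q` with `q = n ε / γ` and `R ≤ q
< R + 1`. If `m` lies on step `k` of the first staircase, the other argument is therefore at most `n
- R - k` atoms, and its inverse is at most the time of target `k + R`. Conversely, a suitable `m` on
step `k` reaches both times. -/
theorem sumSet_isLUB (hn : 0 < n)
    (hsort₀ : Monotone fun i => entranceTime v ω (X₀ i))
    (hsort₁ : Antitone fun i => backwardEntranceTime v ω (X₁ i))
    (hγ : 0 < γ) (hε : 0 ≤ ε) (hεγ : ε < γ) :
    IsLUB (sumSet v ω (atomicMeasure (γ / n) X₀) (atomicMeasure (γ / n) X₁) ε)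
      (maxSum v ω X₀ X₁ ε γ) := by
  classical
  have hn' : (0 : ℝ) < n := by exact_mod_cast hn
  set c : ℝ := γ / n with hc_def
  have hc : 0 < c := div_pos hγ hn'
  have hcn : c * n = γ := div_mul_cancel₀ _ hn'.ne'
  have hmass : (atomicMeasure c X₀).real Set.univ = γ := by
    rw [atomicMeasure_real hc.le]
    simpa using hcn
  have hR := leftover_lt hn hγ hεγ
  set R := leftover n ε γ with hR_def
  set q : ℝ := n * ε / γ with hq
  have hq0 : 0 ≤ q := by positivity
  have hcq : c * q = ε := by
    rw [hq, hc_def]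
    field_simp
  have hRq : (R : ℝ) ≤ q := Nat.floor_le hq0
  have hqR : q < R + 1 := Nat.lt_floor_add_one q
  have hRn : (R : ℝ) + 1 ≤ n := by exact_mod_cast hR
  have h0 : ∀ t, forwardMass v ω (atomicMeasure c X₀) t = c * (Finset.univ.filter fun i =>
      entranceTime v ω (X₀ i) ≤ t).card := fun t => forwardMass_atomicMeasure hc X₀ t
  have h1 : ∀ t, backwardMass v ω (atomicMeasure c X₁) t = c * (Finset.univ.filter fun i =>
      backwardEntranceTime v ω (X₁ (Fin.rev i)) ≤ t).card := fun t => by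
    rw [backwardMass_atomicMeasure hc X₁ t]
    congr 2
    exact Finset.card_equiv Fin.revPerm fun i => by simp
  -- Targets are numbered by decreasing time; reversing the indices gives the increasing order that
  -- the staircase lemmas use.
  have hrev : Monotone fun i : Fin n => backwardEntranceTime v ω (X₁ (Fin.rev i)) :=
    fun i j hij => hsort₁ (Fin.rev_le_rev.2 hij)
  have hnn0 : ∀ i, 0 ≤ entranceTime v ω (X₀ i) := fun i => entranceTime_nonneg _
  have hnn1 : ∀ i, 0 ≤ backwardEntranceTime v ω (X₁ (Fin.rev i)) :=
    fun i => backwardEntranceTime_nonneg _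
  have hrevk : ∀ k : ℕ, ∀ hk : k < n - R, Fin.rev (⟨n - R - 1 - k, by omega⟩ : Fin n) =
      ⟨k + R, by omega⟩ := fun k hk => by
    ext
    simp only [Fin.val_rev]
    omega
  have hcast : ∀ k : ℕ, k < n - R → ((n - R - 1 - k : ℕ) : ℝ) = n - R - 1 - k := fun k hk => by
    rw [Nat.cast_sub (by omega), Nat.cast_sub (by omega), Nat.cast_sub (by omega)]
    simp
  rw [sumSet, hmass]
  constructor
  · rintro _ ⟨m, ⟨hm0, hm1⟩, rfl⟩
    obtain ⟨k, hkm, hmk⟩ : ∃ k : ℕ, (k = 0 ∨ c * k < m) ∧ m ≤ c * (k + 1) := by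
      rcases Nat.eq_zero_or_pos ⌈m / c⌉₊ with h | h
      · refine ⟨0, Or.inl rfl, ?_⟩
        have := (Nat.ceil_eq_zero.1 h)
        rw [div_le_iff₀ hc] at this
        push_cast
        linarith
      · refine ⟨⌈m / c⌉₊ - 1, Or.inr ?_, ?_⟩
        · have h2 : ((⌈m / c⌉₊ - 1 : ℕ) : ℝ) < m / c := Nat.lt_ceil.1 (by omega)
          rwa [lt_div_iff₀ hc, mul_comm] at h2
        · have h2 := Nat.le_ceil (m / c)
          rw [div_le_iff₀ hc, mul_comm] at h2
          rwa [Nat.cast_sub h, Nat.cast_one, sub_add_cancel]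
    have hkm' : c * k ≤ m := by
      rcases hkm with h | h
      · simpa [h] using hm0
      · exact h.le
    have hk : k < n - R := by
      rcases hkm with h | h
      · omega
      · have h2 : c * (k + R) < c * n := by nlinarith
        have h3 : (k + R : ℝ) < n := lt_of_mul_lt_mul_left h2 hc.le
        have h4 : k + R < n := by exact_mod_cast h3
        omega
    have hF := genInv_le hc hsort₀ hnn0 h0 (k := ⟨k, by omega⟩) hmk
    have hB := genInv_le hc hrev hnn1 h1 (m := γ - ε - m) (k := ⟨n - R - 1 - k, by omega⟩) (by
      simp only
      rw [hcast k hk]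
      nlinarith)
    simp only [hrevk k hk] at hB
    exact (add_le_add hF hB).trans (le_maxSum k hk)
  · intro b hb
    have : Nonempty (Fin (n - R)) := ⟨⟨0, by omega⟩⟩
    refine ciSup_le fun k => ?_
    have hk := k.2
    have hkn : (k : ℝ) + R + 1 ≤ n := by
      have : (k : ℕ) + R + 1 ≤ n := by omega
      exact_mod_cast this
    -- For `m = c (k + δ)` to lie beyond `c k`, and the remainder `c (n - q - k - δ)` beyond `c (n -
    -- R - 1 - k)`, one needs `0 < δ < 1 + R - q`; the midpoint is taken.
    have hδ : 0 < (1 + R - q) / 2 := by linarith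
    have hδ' : (1 + R - q) / 2 ≤ 1 := by linarith
    set δ := (1 + R - q) / 2 with hδ_def
    have hk0 : (0 : ℝ) ≤ k := Nat.cast_nonneg _
    have hm0 : 0 ≤ c * (k + δ) := by positivity
    have hm1 : c * (n - R - 1 - k) < γ - ε - c * (k + δ) := by
      have h2 : c * (n - R - 1 - k) < c * (n - q - (k + δ)) :=
        mul_lt_mul_of_pos_left (by linarith) hc
      linarith
    have hpos : 0 ≤ c * (n - R - 1 - k) := mul_nonneg hc.le (by linarith)
    refine le_trans (add_le_add ?_ ?_) (hb ⟨c * (k + δ), ⟨hm0, by linarith⟩, rfl⟩)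
    · refine le_genInv hc hsort₀ hnn0 h0 (k := ⟨k, by omega⟩) ?_ ?_
      · simp only
        nlinarith
      · linarith
    · have := le_genInv hc hrev hnn1 h1 (m := γ - ε - c * (k + δ))
        (k := ⟨n - R - 1 - k, by omega⟩) (by
          simp only
          rwa [hcast k hk]) (by linarith)
      simpa only [hrevk k hk] using this

end SupSum

/-! ### Realizing disjoint curves by one control. -/

section Realization

variable {d : ℕ} {v : State d → State d} {ω : Set (State d)}

theorem isTrajectory_of_isIntegralCurve (hv : GoodField v) {u : ℝ → State d → State d}
    {L : ℝ≥0} (hL : ∀ t, LipschitzWith L (localized ω u t))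
    (hc : ∀ x, Continuous fun t => localized ω u t x) {γ : ℝ → State d}
    (hγ : IsIntegralCurve γ fun t x => v x + localized ω u t x) :
    IsTrajectory v ω u (γ 0) γ := by
  have hγc : Continuous γ := hγ.continuous
  have hjoint : Continuous fun q : ℝ × State d => localized ω u q.1 q.2 :=
    continuous_prod_of_continuous_lipschitzWith' _ L hL hc
  have hw : Continuous fun t => v (γ t) + localized ω u t (γ t) :=
    (hv.continuous.comp hγc).add (hjoint.comp (continuous_id.prodMk hγc))
  refine ⟨hγc.continuousOn, fun t _ => ?_⟩
  rw [intervalIntegral.integral_eq_sub_of_hasDerivAt (fun s _ => hγ s) (hw.intervalIntegrable _ _)]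
  abel

/-- Phrased as an eventual property at `0⁺` so that finitely many margins can be combined. -/
theorem eventually_forall_le_of_pos {K : Set ℝ} (hK : IsCompact K) {f : ℝ → ℝ}
    (hf : Continuous f) (hpos : ∀ t, 0 < f t) :
    ∀ᶠ δ in nhdsWithin (0 : ℝ) (Set.Ioi 0), ∀ t ∈ K, δ ≤ f t := by
  obtain ⟨a, ha, h⟩ := hK.exists_forall_le' hf.continuousOn (a := 0) fun t _ => hpos t
  filter_upwards [Ioo_mem_nhdsGT ha] with δ hδ t ht
  exact hδ.2.le.trans (h t ht)

theorem eventually_ball_subset {K : Set ℝ} (hK : IsCompact K) (hω : IsOpen ω) {f : ℝ → State d}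
    (hf : Continuous f) (hmem : ∀ t ∈ K, f t ∈ ω) :
    ∀ᶠ δ in nhdsWithin (0 : ℝ) (Set.Ioi 0), ∀ t ∈ K, Metric.ball (f t) δ ⊆ ω := by
  obtain ⟨a, ha, h⟩ := (hK.image hf).exists_thickening_subset_open hω
    (Set.image_subset_iff.2 fun t ht => hmem t ht)
  filter_upwards [Ioo_mem_nhdsGT ha] with δ hδ t ht
  refine Set.Subset.trans (Metric.ball_subset_ball hδ.2.le) (Set.Subset.trans ?_ h)
  exact Metric.ball_subset_thickening (Set.mem_image_of_mem f ht) a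

/-- Pairwise disjoint `C¹` curves that follow the field `v` except on time intervals during which
they stay in `ω` are trajectories of one admissible control, which can be chosen such that
every initial point has a trajectory. -/
theorem exists_admissible_of_curves (hv : GoodField v) (hω : IsOpen ω) {N : ℕ}
    {p : Fin N → ℝ → State d} {s s' : Fin N → ℝ} {T : ℝ} (hs : ∀ i, 0 ≤ s i)
    (hs' : ∀ i, s' i ≤ T) (hp : ∀ i, ContDiff ℝ 1 (p i))
    (hout : ∀ i, ∀ t ∉ Set.Icc (s i) (s' i), HasDerivAt (p i) (v (p i t)) t)
    (hin : ∀ i, ∀ t ∈ Set.Icc (s i) (s' i), p i t ∈ ω)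
    (hdisj : ∀ i j, i ≠ j → ∀ t, p i t ≠ p j t) :
    ∃ u, Admissible ω u ∧ (∀ i, IsTrajectory v ω u (p i 0) (p i)) ∧
      ∀ x₀, ∃ x, IsTrajectory v ω u x₀ x := by
  have hpc : ∀ i, Continuous (p i) := fun i => (hp i).continuous
  obtain ⟨r, hr, hr1, hr2⟩ : ∃ r > 0, (∀ i j, i ≠ j → ∀ t ∈ Set.Icc 0 T, r ≤ dist (p i t) (p j t)) ∧
      ∀ i, ∀ t ∈ Set.Icc (s i) (s' i), Metric.ball (p i t) r ⊆ ω := by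
    have h1 : ∀ᶠ r in nhdsWithin (0 : ℝ) (Set.Ioi 0), ∀ i j, i ≠ j →
        ∀ t ∈ Set.Icc 0 T, r ≤ dist (p i t) (p j t) :=
      Filter.eventually_all.2 fun i => Filter.eventually_all.2 fun j =>
        Filter.eventually_imp_distrib_left.2 fun hij =>
          eventually_forall_le_of_pos isCompact_Icc ((hpc i).dist (hpc j))
            fun t => dist_pos.2 (hdisj i j hij t)
    have h2 : ∀ᶠ r in nhdsWithin (0 : ℝ) (Set.Ioi 0), ∀ i, ∀ t ∈ Set.Icc (s i) (s' i),
        Metric.ball (p i t) r ⊆ ω :=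
      Filter.eventually_all.2 fun i => eventually_ball_subset isCompact_Icc hω (hpc i) (hin i)
    obtain ⟨r, ⟨hr1, hr2⟩, hr⟩ := ((h1.and h2).and self_mem_nhdsWithin).exists
    exact ⟨r, hr, hr1, hr2⟩
  -- The velocity correction that curve `i` requires; it vanishes outside the control phase.
  let c : Fin N → ℝ → State d := fun i t => deriv (p i) t - v (p i t)
  have hcc : ∀ i, Continuous (c i) := fun i =>
    ((contDiff_one_iff_deriv.1 (hp i)).2).sub (hv.continuous.comp (hpc i))
  have hc0 : ∀ i, ∀ t ∉ Set.Icc (s i) (s' i), c i t = 0 := fun i t ht =>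
    sub_eq_zero.2 (hout i t ht).deriv
  have hcb : ∀ i, ∃ C, ∀ t, ‖c i t‖ ≤ C := fun i => by
    obtain ⟨C, hC⟩ := isCompact_Icc.exists_bound_of_continuousOn (s := Set.Icc (s i) (s' i))
      (hcc i).continuousOn
    refine ⟨max C 0, fun t => ?_⟩
    by_cases ht : t ∈ Set.Icc (s i) (s' i)
    · exact (hC t ht).trans (le_max_left _ _)
    · rw [hc0 i t ht, norm_zero]
      exact le_max_right _ _
  choose C hC using hcb
  have hC0 : ∀ i, 0 ≤ C i := fun i => (norm_nonneg _).trans (hC i 0)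
  let ψ : ℝ → ℝ := fun a => max (1 - a / r) 0
  have hψ0 : ψ 0 = 1 := by simp [ψ]
  have hψr : ∀ a, r ≤ a → ψ a = 0 := fun a ha => by
    refine max_eq_right ?_
    rw [sub_nonpos, le_div_iff₀ hr, one_mul]
    exact ha
  have hψnn : ∀ a, 0 ≤ ψ a := fun a => le_max_right _ _
  have hψ1 : ∀ a, 0 ≤ a → ψ a ≤ 1 := fun a ha =>
    max_le (by linarith [div_nonneg ha hr.le]) zero_le_one
  have hψL : ∀ a b, |ψ a - ψ b| ≤ r⁻¹ * |a - b| := fun a b => by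
    refine (abs_max_sub_max_le_abs _ _ _).trans (le_of_eq ?_)
    rw [show 1 - a / r - (1 - b / r) = r⁻¹ * (b - a) by ring, abs_mul, abs_sub_comm b a,
      abs_of_pos (inv_pos.2 hr)]
  have hψc : Continuous ψ := by fun_prop
  let u : ℝ → State d → State d := fun t x => ∑ i, ψ ‖x - p i t‖ • c i t
  -- Whenever a correction is nonzero, its tent is supported inside `ω`, so cutting off at the
  -- boundary creates no discontinuity.
  have hloc : ∀ t x, localized ω u t x = u t x := fun t x => by
    by_cases hx : x ∈ ω
    · exact Set.indicator_of_mem hx _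
    · rw [localized, Set.indicator_of_notMem hx]
      refine (Finset.sum_eq_zero fun i _ => ?_).symm
      by_cases ht : t ∈ Set.Icc (s i) (s' i)
      · rw [hψr, zero_smul]
        by_contra! h
        exact hx (hr2 i t ht (mem_ball_iff_norm.2 h))
      · rw [hc0 i t ht, smul_zero]
  have hLip : ∀ t, LipschitzWith (Real.toNNReal (∑ i, r⁻¹ * C i)) (localized ω u t) := fun t => by
    refine LipschitzWith.of_dist_le' fun x y => ?_
    rw [hloc, hloc, dist_eq_norm, dist_eq_norm, ← Finset.sum_sub_distrib, Finset.sum_mul]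
    refine (norm_sum_le _ _).trans (Finset.sum_le_sum fun i _ => ?_)
    rw [← sub_smul, norm_smul, Real.norm_eq_abs]
    have h1 := hψL ‖x - p i t‖ ‖y - p i t‖
    have h2 : |‖x - p i t‖ - ‖y - p i t‖| ≤ ‖x - y‖ := by
      simpa using abs_norm_sub_norm_le (x - p i t) (y - p i t)
    calc |ψ ‖x - p i t‖ - ψ ‖y - p i t‖| * ‖c i t‖
        ≤ (r⁻¹ * ‖x - y‖) * C i :=
          mul_le_mul (h1.trans (mul_le_mul_of_nonneg_left h2 (inv_pos.2 hr).le)) (hC i t)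
            (norm_nonneg _) (mul_nonneg (inv_pos.2 hr).le (norm_nonneg _))
      _ = r⁻¹ * C i * ‖x - y‖ := by ring
  have hcont : ∀ x, Continuous fun t => localized ω u t x := fun x => by
    simp only [hloc]
    exact continuous_finsetSum _ fun i _ =>
      (hψc.comp (continuous_const.sub (hpc i)).norm).smul (hcc i)
  have hbdd : ∀ t x, ‖localized ω u t x‖ ≤ ∑ i, C i := fun t x => by
    rw [hloc]
    refine (norm_sum_le _ _).trans (Finset.sum_le_sum fun i _ => ?_)
    rw [norm_smul, Real.norm_of_nonneg (hψnn _)]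
    exact (mul_le_of_le_one_left (norm_nonneg _) (hψ1 _ (norm_nonneg _))).trans (hC i t)
  -- During `[0, T]` the other curves are at distance at least `r` and their tents vanish; at other
  -- times all corrections vanish.
  have hup : ∀ i t, u t (p i t) = c i t := fun i t => by
    by_cases ht : t ∈ Set.Icc 0 T
    · refine (Finset.sum_eq_single i (fun j _ hj => ?_) (by simp)).trans ?_
      · rw [hψr, zero_smul]
        rw [← dist_eq_norm]
        exact hr1 i j hj.symm t ht
      · rw [sub_self, norm_zero, hψ0, one_smul]
    · have h0 : ∀ j, c j t = 0 := fun j => hc0 j t fun h =>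
        ht ⟨(hs j).trans h.1, h.2.trans (hs' j)⟩
      rw [h0 i]
      exact Finset.sum_eq_zero fun j _ => by rw [h0 j, smul_zero]
  refine ⟨u, ⟨⟨_, hLip⟩, fun x => (hcont x).measurable, _, hbdd⟩, fun i => ?_, fun x₀ => ?_⟩
  · refine isTrajectory_of_isIntegralCurve hv hLip hcont fun t => ?_
    have h1 : v (p i t) + localized ω u t (p i t) = deriv (p i) t := by
      rw [hloc, hup]
      exact add_sub_cancel _ _
    simp only [h1]
    exact ((hp i).differentiable one_ne_zero t).hasDerivAt
  · obtain ⟨L, hL⟩ := hv.lip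
    obtain ⟨M, hM⟩ := hv.bdd
    obtain ⟨γ, hγ0, hγ⟩ := exists_isIntegralCurve
      (w := fun t x => v x + localized ω u t x) (fun t => hL.add (hLip t))
      (fun x => continuous_const.add (hcont x))
      (fun t x => (norm_add_le _ _).trans (add_le_add (hM x) (hbdd t x))) x₀
    exact ⟨γ, hγ0 ▸ isTrajectory_of_isIntegralCurve hv hLip hcont hγ⟩

end Realization

/-! ### Steering curves, and general position for `d ≥ 2`. -/

section Curves

variable {d : ℕ} {v : State d → State d} {ω : Set (State d)}

/-- `p` is a `C¹` curve that follows the orbit of `x` until the time `s` and the orbit arriving at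
`y` at time `T` from the time `s'` on, and stays in `ω` in between. -/
structure SteeringCurve (v : State d → State d) (ω : Set (State d)) (x y : State d)
    (T s s' : ℝ) (p : ℝ → State d) : Prop where
  contDiff : ContDiff ℝ 1 p
  eq_left : ∀ t ≤ s, p t = flow v t x
  eq_right : ∀ t, s' ≤ t → p t = flow v (t + -T) y
  mem : ∀ t ∈ Set.Icc s s', p t ∈ ω

/-- Entrance times into and exit times from the control region that are close enough to the
infimum. -/
structure SteeringTimes (v : State d → State d) (ω : Set (State d)) {N : ℕ}
    (x y : Fin N → State d) (T : ℝ) (s s' : Fin N → ℝ) : Prop where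
  lt_left : ∀ i, entranceTime v ω (x i) < s i
  lt_right : ∀ i, s' i < T - backwardEntranceTime v ω (y i)
  mem_left : ∀ i, flow v (s i) (x i) ∈ ω
  mem_right : ∀ i, flow v (s' i + -T) (y i) ∈ ω
  lt : ∀ i j, entranceTime v ω (x i) + backwardEntranceTime v ω (y j) < T → s i < s' j

theorem exists_steeringTimes (hv : GoodField v) (hω : IsOpen ω) {N : ℕ} {x y : Fin N → State d}
    (hx : ∀ i, ∃ t : ℝ, 0 < t ∧ flow v t (x i) ∈ ω)
    (hy : ∀ i, ∃ t : ℝ, 0 < t ∧ flow v (-t) (y i) ∈ ω) (T : ℝ) :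
    ∃ s s', SteeringTimes v ω x y T s s' := by
  -- One margin serves all pairs, also those with `i ≠ j`: these keep an agent still entering apart
  -- from another one already leaving.
  have hη : ∀ᶠ η in nhdsWithin (0 : ℝ) (Set.Ioi 0), ∀ i j,
      entranceTime v ω (x i) + backwardEntranceTime v ω (y j) < T →
      entranceTime v ω (x i) + η < T - (backwardEntranceTime v ω (y j) + η) :=
    Filter.eventually_all.2 fun i => Filter.eventually_all.2 fun j =>
      Filter.eventually_imp_distrib_left.2 fun hij => by
        filter_upwards [Ioo_mem_nhdsGT (show 0 <
          (T - (entranceTime v ω (x i) + backwardEntranceTime v ω (y j))) / 2 by linarith)]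
          with η hη
        linarith [hη.2]
  obtain ⟨η, hη, hη0⟩ := (hη.and self_mem_nhdsWithin).exists
  have hη0 : 0 < η := hη0
  choose s hs1 hs2 hs3 using fun i => exists_flow_mem hv hω (hx i)
    (b := entranceTime v ω (x i) + η) (by linarith)
  choose r hr1 hr2 hr3 using fun i => exists_flow_neg_mem hv hω (hy i)
    (b := backwardEntranceTime v ω (y i) + η) (by linarith)
  refine ⟨s, fun i => T - r i, hs1, fun i => by linarith [hr1 i], hs3, fun i => ?_,
    fun i j hij => by linarith [hη i j hij, hs2 i, hr2 j]⟩
  rw [show T - r i + -T = -r i by ring]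
  exact hr3 i

/-- Orbits in the entrance phase and orbits in the exit phase do not meet. -/
theorem SteeringTimes.flow_ne (hv : GoodField v) (hω : IsOpen ω) {N : ℕ} {x y : Fin N → State d}
    {T : ℝ} {s s' : Fin N → ℝ} (h : SteeringTimes v ω x y T s s')
    (hx : ∀ i, ∃ t : ℝ, 0 < t ∧ flow v t (x i) ∈ ω) (hT : ∀ i, entranceTime v ω (x i) < T)
    {i j : Fin N} {t : ℝ} (h1 : t ≤ s i) (h2 : s' j ≤ t) :
    flow v t (x i) ≠ flow v (t + -T) (y j) := by
  intro heq
  -- A meeting would put `x i` and `y j` on one free orbit, joined in time `T`; then `s i < s' j`,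
  -- contrary to `s' j ≤ t ≤ s i`.
  have h3 := congrArg (flow v (T - t)) heq
  rw [hv.flow_flow, hv.flow_flow, sub_add_cancel, show T - t + (t + -T) = 0 by ring,
    hv.flow_zero] at h3
  have h4 := h.lt i j (entranceTime_add_lt_of_flow_eq hv hω (hx i) h3 (hT i))
  linarith

theorem SteeringCurve.hasDerivAt (hv : GoodField v) {x y : State d} {T s s' : ℝ}
    {p : ℝ → State d} (hp : SteeringCurve v ω x y T s s' p) :
    ∀ t ∉ Set.Icc s s', HasDerivAt p (v (p t)) t := by
  intro t ht
  rcases lt_or_ge t s with h | h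
  · rw [hp.eq_left t h.le]
    refine (hv.hasDerivAt_flow x t).congr_of_eventuallyEq ?_
    filter_upwards [Iio_mem_nhds h] with r hr using hp.eq_left r (le_of_lt hr)
  · have h' : s' < t := by
      by_contra! h'
      exact ht ⟨h, h'⟩
    rw [hp.eq_right t h'.le]
    refine (hv.hasDerivAt_flow_add y (-T) t).congr_of_eventuallyEq ?_
    filter_upwards [Ioi_mem_nhds h'] with r hr using hp.eq_right r (le_of_lt hr)

variable {E : Type*} [NormedAddCommGroup E] [NormedSpace ℝ E]

/-- Points of a connected open set are joined by `C¹` paths that are constant near the ends. -/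
theorem exists_contDiff_path {U : Set E} (hU : IsOpen U) (hUc : IsPreconnected U) {a b : E}
    (ha : a ∈ U) (hb : b ∈ U) :
    ∃ h : ℝ → E, ContDiff ℝ 1 h ∧ (∀ t ≤ 0, h t = a) ∧ (∀ t, 1 ≤ t → h t = b) ∧ ∀ t, h t ∈ U := by
  refine hUc.induction₂ (fun a b => ∃ h : ℝ → E, ContDiff ℝ 1 h ∧ (∀ t ≤ 0, h t = a) ∧
    (∀ t, 1 ≤ t → h t = b) ∧ ∀ t, h t ∈ U) (fun x hx => ?_) (fun x y z _ hy _ => ?_)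
    (fun x y _ _ => ?_) ha hb
  · obtain ⟨ε, hε, hball⟩ := Metric.isOpen_iff.1 hU x hx
    filter_upwards [mem_nhdsWithin_of_mem_nhds (Metric.ball_mem_nhds x hε)] with y hy
    refine ⟨fun t => AffineMap.lineMap x y (Real.smoothTransition t), ?_, fun t ht => ?_,
      fun t ht => ?_, fun t => hball ?_⟩
    · simp only [AffineMap.lineMap_apply_module']
      exact ((Real.smoothTransition.contDiff (n := 1)).smul contDiff_const).add contDiff_const
    · simp [Real.smoothTransition.zero_of_nonpos ht]
    · simp [Real.smoothTransition.one_of_one_le ht]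
    · exact (convex_ball x ε).lineMap_mem (Metric.mem_ball_self hε) hy
        ⟨Real.smoothTransition.nonneg t, Real.smoothTransition.le_one t⟩
  · rintro ⟨h₁, hc₁, h₁l, h₁r, h₁U⟩ ⟨h₂, hc₂, h₂l, h₂r, h₂U⟩
    -- On each half one of the two paths rests at `y`, so this sum is the concatenation, and it is
    -- visibly `C¹`.
    refine ⟨fun t => h₁ (2 * t) + h₂ (2 * t - 1) - y, ?_, fun t ht => ?_, fun t ht => ?_,
      fun t => ?_⟩
    · exact ((hc₁.comp (contDiff_const.mul contDiff_id)).add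
        (hc₂.comp ((contDiff_const.mul contDiff_id).sub contDiff_const))).sub contDiff_const
    · simp only
      rw [h₁l _ (by linarith), h₂l _ (by linarith), add_sub_cancel_right]
    · simp only
      rw [h₁r _ (by linarith), h₂r _ (by linarith), add_sub_cancel_left]
    · rcases le_total t (1 / 2) with ht | ht
      · simp only
        rw [h₂l _ (by linarith), add_sub_cancel_right]
        exact h₁U _
      · simp only
        rw [h₁r _ (by linarith), add_sub_cancel_left]
        exact h₂U _
  · rintro ⟨h, hc, hl, hr, hU⟩
    refine ⟨fun t => h (1 - t), hc.comp (contDiff_const.sub contDiff_id), fun t ht => hr _ ?_,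
      fun t ht => hl _ ?_, fun t => hU _⟩ <;> linarith

/-- A `C¹` curve that switches from `f` to `g` inside a connected open set. -/
theorem exists_contDiff_switch {U : Set E} (hU : IsOpen U) (hUc : IsPreconnected U)
    {f g : ℝ → E} (hf : ContDiff ℝ 1 f) (hg : ContDiff ℝ 1 g) {s s' : ℝ} (hss : s < s')
    (hfs : f s ∈ U) (hgs : g s' ∈ U) :
    ∃ p : ℝ → E, ContDiff ℝ 1 p ∧ (∀ t ≤ s, p t = f t) ∧ (∀ t, s' ≤ t → p t = g t) ∧
      ∀ t ∈ Set.Icc s s', p t ∈ U := by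
  obtain ⟨ε, hε, hA⟩ := Metric.isOpen_iff.1 hU _ hfs
  obtain ⟨ε', hε', hB⟩ := Metric.isOpen_iff.1 hU _ hgs
  obtain ⟨h, hc, hl, hr, hhU⟩ := exists_contDiff_path hU hUc hfs hgs
  obtain ⟨δ₁, hδ₁, hfδ⟩ := Metric.continuous_iff.1 hf.continuous s ε hε
  obtain ⟨δ₂, hδ₂, hgδ⟩ := Metric.continuous_iff.1 hg.continuous s' ε' hε'
  obtain ⟨δ, hδ, hδ1, hδ2, hδ3⟩ : ∃ δ > 0, δ < δ₁ ∧ δ < δ₂ ∧ s + δ < s' - δ := by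
    refine ⟨min (min δ₁ δ₂) (s' - s) / 3, by positivity, ?_, ?_, ?_⟩
    · have := (min_le_left (min δ₁ δ₂) (s' - s)).trans (min_le_left _ _)
      linarith
    · have := (min_le_left (min δ₁ δ₂) (s' - s)).trans (min_le_right _ _)
      linarith
    · have := min_le_right (min δ₁ δ₂) (s' - s)
      linarith
  set S := Real.smoothTransition with hS
  have hSc : ContDiff ℝ 1 S := Real.smoothTransition.contDiff (n := 1)
  have hS0 : ∀ t, t ≤ 0 → S t = 0 := fun t => Real.smoothTransition.zero_of_nonpos
  have hS1 : ∀ t, 1 ≤ t → S t = 1 := fun t => Real.smoothTransition.one_of_one_le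
  have hSnn : ∀ t, 0 ≤ S t := Real.smoothTransition.nonneg
  have hSle : ∀ t, S t ≤ 1 := Real.smoothTransition.le_one
  -- The path `w` rests at `f s` until `s + δ` and at `g s'` from `s' - δ` on. The deviations of `f`
  -- and `g` from these points are switched off and on only while `w` rests, where they are too
  -- small to leave `U`.
  set α : ℝ → ℝ := fun t => 1 - S ((t - s) / δ) with hα
  set κ : ℝ → ℝ := fun t => S ((t - (s' - δ)) / δ) with hκ
  have hα1 : ∀ t, t ≤ s → α t = 1 := fun t ht => by
    rw [hα]
    simp only
    rw [hS0 _ (div_nonpos_of_nonpos_of_nonneg (by linarith) hδ.le), sub_zero]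
  have hα0 : ∀ t, s + δ ≤ t → α t = 0 := fun t ht => by
    rw [hα]
    simp only
    rw [hS1 _ ((one_le_div hδ).2 (by linarith)), sub_self]
  have hκ0 : ∀ t, t ≤ s' - δ → κ t = 0 := fun t ht =>
    hS0 _ (div_nonpos_of_nonpos_of_nonneg (by linarith) hδ.le)
  have hκ1 : ∀ t, s' ≤ t → κ t = 1 := fun t ht => hS1 _ ((one_le_div hδ).2 (by linarith))
  have hα2 : ∀ t, |α t| ≤ 1 := fun t => abs_le.2
    ⟨by linarith [hSle ((t - s) / δ)], by linarith [hSnn ((t - s) / δ)]⟩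
  have hκ2 : ∀ t, |κ t| ≤ 1 := fun t => abs_le.2
    ⟨by linarith [hSnn ((t - (s' - δ)) / δ)], hSle _⟩
  set w : ℝ → E := fun t => h ((t - (s + δ)) / (s' - δ - (s + δ))) with hw
  have hwA : ∀ t, t ≤ s + δ → w t = f s := fun t ht =>
    hl _ (div_nonpos_of_nonpos_of_nonneg (by linarith) (by linarith))
  have hwB : ∀ t, s' - δ ≤ t → w t = g s' := fun t ht =>
    hr _ ((one_le_div (by linarith)).2 (by linarith))
  refine ⟨fun t => w t + α t • (f t - f s) + κ t • (g t - g s'), ?_, fun t ht => ?_,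
    fun t ht => ?_, fun t ht => ?_⟩
  · refine ((hc.comp ((contDiff_id.sub contDiff_const).div_const _)).add
      (ContDiff.smul ?_ (hf.sub contDiff_const))).add
      (ContDiff.smul ?_ (hg.sub contDiff_const))
    · exact contDiff_const.sub (hSc.comp ((contDiff_id.sub contDiff_const).div_const _))
    · exact hSc.comp ((contDiff_id.sub contDiff_const).div_const _)
  · simp only
    rw [hwA t (by linarith), hα1 t ht, hκ0 t (by linarith), one_smul, zero_smul, add_zero,
      add_sub_cancel]
  · simp only
    rw [hwB t (by linarith), hα0 t (by linarith), hκ1 t ht, one_smul, zero_smul, add_zero,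
      add_sub_cancel]
  · simp only
    rcases le_total t (s + δ) with h1 | h1
    · rw [hwA t h1, hκ0 t (by linarith), zero_smul, add_zero]
      refine hA (mem_ball_iff_norm.2 ?_)
      rw [add_sub_cancel_left, norm_smul]
      refine (mul_le_of_le_one_left (norm_nonneg _) (hα2 t)).trans_lt ?_
      rw [← dist_eq_norm]
      refine hfδ t ?_
      rw [Real.dist_eq, abs_of_nonneg (by linarith [ht.1])]
      linarith
    · rw [hα0 t h1, zero_smul, add_zero]
      rcases le_total t (s' - δ) with h2 | h2
      · rw [hκ0 t h2, zero_smul, add_zero]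
        exact hhU _
      · rw [hwB t h2]
        refine hB (mem_ball_iff_norm.2 ?_)
        rw [add_sub_cancel_left, norm_smul]
        refine (mul_le_of_le_one_left (norm_nonneg _) (hκ2 t)).trans_lt ?_
        rw [← dist_eq_norm]
        refine hgδ t ?_
        rw [Real.dist_eq, abs_of_nonpos (by linarith [ht.2])]
        linarith

theorem exists_steeringCurve (hv : GoodField v) (hω : IsOpen ω) (hωc : IsPreconnected ω)
    {x y : State d} {T s s' : ℝ} (hss : s < s') (hx : flow v s x ∈ ω)
    (hy : flow v (s' + -T) y ∈ ω) : ∃ p, SteeringCurve v ω x y T s s' p := by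
  obtain ⟨p, h1, h2, h3, h4⟩ := exists_contDiff_switch hω hωc (hv.contDiff_flow x)
    (g := fun t => flow v (t + -T) y)
    ((hv.contDiff_flow y).comp (contDiff_id.add contDiff_const)) hss hx hy
  exact ⟨p, h1, h2, h3, h4⟩

/-- In dimension at least two a small perturbation makes a steering curve avoid finitely many
`C¹` curves during the control phase. -/
theorem SteeringCurve.exists_avoiding (hd : 2 ≤ d) (hω : IsOpen ω) {x y : State d}
    {T s s' : ℝ} {p : ℝ → State d} (hp : SteeringCurve v ω x y T s s' p) {ι : Type*}
    [Finite ι] {q : ι → ℝ → State d} (hq : ∀ j, ContDiff ℝ 1 (q j)) :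
    ∃ p', SteeringCurve v ω x y T s s' p' ∧ ∀ j, ∀ t ∈ Set.Ioo s s', p' t ≠ q j t := by
  have : Countable ι := Finite.to_countable
  set θ : ℝ → ℝ := fun t => Real.smoothTransition (t - s) * Real.smoothTransition (s' - t) with hθ
  have hθc : ContDiff ℝ 1 θ :=
    ((Real.smoothTransition.contDiff (n := 1)).comp (contDiff_id.sub contDiff_const)).mul
      ((Real.smoothTransition.contDiff (n := 1)).comp (contDiff_const.sub contDiff_id))
  have hθpos : ∀ t ∈ Set.Ioo s s', 0 < θ t := fun t ht =>
    mul_pos (Real.smoothTransition.pos_of_pos (by linarith [ht.1]))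
      (Real.smoothTransition.pos_of_pos (by linarith [ht.2]))
  have hθl : ∀ t ≤ s, θ t = 0 := fun t ht => by
    simp only [hθ]
    rw [Real.smoothTransition.zero_of_nonpos (by linarith), zero_mul]
  have hθr : ∀ t, s' ≤ t → θ t = 0 := fun t ht => by
    simp only [hθ]
    rw [Real.smoothTransition.zero_of_nonpos (x := s' - t) (by linarith), mul_zero]
  have hθ1 : ∀ t, |θ t| ≤ 1 := fun t => by
    rw [abs_of_nonneg (mul_nonneg (Real.smoothTransition.nonneg _) (Real.smoothTransition.nonneg _))]
    exact mul_le_one₀ (Real.smoothTransition.le_one _) (Real.smoothTransition.nonneg _)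
      (Real.smoothTransition.le_one _)
  obtain ⟨ε, hε, hε0⟩ := ((eventually_ball_subset isCompact_Icc hω hp.contDiff.continuous
    hp.mem).and self_mem_nhdsWithin).exists
  have hε0 : 0 < ε := hε0
  -- The bad vectors: `p + θ • w` meets `q j` at time `t` exactly if `w` is this quotient. As `C¹`
  -- images of an interval they have dimension at most one, which is less than `d`.
  set B : Set (State d) := ⋃ j, (fun t => (θ t)⁻¹ • (q j t - p t)) '' Set.Ioo s s' with hB
  have hdim : dimH B < Module.finrank ℝ (State d) := by
    rw [hB, dimH_iUnion]
    have h1 : (⨆ j, dimH ((fun t => (θ t)⁻¹ • (q j t - p t)) '' Set.Ioo s s')) ≤ 1 := by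
      refine iSup_le fun j => ?_
      have hcd : ContDiffOn ℝ 1 (fun t => (θ t)⁻¹ • (q j t - p t)) (Set.Ioo s s') :=
        (hθc.contDiffOn.inv fun t ht => (hθpos t ht).ne').smul
          ((hq j).sub hp.contDiff).contDiffOn
      refine (hcd.dimH_image_le (convex_Ioo s s') Set.Subset.rfl).trans ?_
      exact (dimH_mono (Set.subset_univ _)).trans_eq Real.dimH_univ
    refine h1.trans_lt ?_
    rw [finrank_euclideanSpace_fin]
    exact_mod_cast hd
  obtain ⟨w, hwB, hw⟩ := (dense_compl_of_dimH_lt_finrank hdim).exists_dist_lt 0 hε0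
  rw [dist_zero_left] at hw
  refine ⟨fun t => p t + θ t • w, ⟨hp.contDiff.add (hθc.smul contDiff_const), fun t ht => ?_,
    fun t ht => ?_, fun t ht => hε t ht ?_⟩, fun j t ht heq => hwB ?_⟩
  · rw [hθl t ht, zero_smul, add_zero, hp.eq_left t ht]
  · rw [hθr t ht, zero_smul, add_zero, hp.eq_right t ht]
  · rw [mem_ball_iff_norm, add_sub_cancel_left, norm_smul]
    exact (mul_le_of_le_one_left (norm_nonneg _) (hθ1 t)).trans_lt hw
  · refine Set.mem_iUnion.2 ⟨j, t, ht, ?_⟩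
    simp only at heq ⊢
    rw [← heq, add_sub_cancel_left, inv_smul_smul₀ (hθpos t ht).ne']

/-- The curves are perturbed one at a time, which excludes meetings while at least one of them is
controlled. If neither is, both follow free orbits: two entering or two leaving agents are separated
by injectivity of the flow, the mixed case by `SteeringTimes.flow_ne`. -/
theorem exists_disjoint_steeringCurves_of_two_le (hd : 2 ≤ d) (hv : GoodField v) (hω : IsOpen ω)
    (hωc : IsPreconnected ω) {N : ℕ} {x y : Fin N → State d} (hxi : Function.Injective x)
    (hyi : Function.Injective y) (hx : ∀ i, ∃ t : ℝ, 0 < t ∧ flow v t (x i) ∈ ω)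
    {T : ℝ} (hT : ∀ i, entranceTime v ω (x i) + backwardEntranceTime v ω (y i) < T)
    {s s' : Fin N → ℝ} (hs : SteeringTimes v ω x y T s s') :
    ∃ p : Fin N → ℝ → State d, (∀ i, SteeringCurve v ω (x i) (y i) T (s i) (s' i) (p i)) ∧
      ∀ i j, i ≠ j → ∀ t, p i t ≠ p j t := by
  classical
  have key : ∀ S : Finset (Fin N), ∃ p : Fin N → ℝ → State d,
      (∀ i, SteeringCurve v ω (x i) (y i) T (s i) (s' i) (p i)) ∧
      ∀ i ∈ S, ∀ j, i ≠ j → ∀ t ∈ Set.Ioo (s i) (s' i), p i t ≠ p j t := by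
    intro S
    induction S using Finset.induction_on with
    | empty =>
      choose p hp using fun i => exists_steeringCurve hv hω hωc (hs.lt i i (hT i))
        (hs.mem_left i) (hs.mem_right i)
      exact ⟨p, hp, by simp⟩
    | insert k S hk ih =>
      obtain ⟨p, hp, hS⟩ := ih
      obtain ⟨p', hp', hne⟩ := (hp k).exists_avoiding hd hω (ι := Fin N) (q := p)
        fun j => (hp j).contDiff
      have hout : ∀ t ∉ Set.Ioo (s k) (s' k), p' t = p k t := fun t ht => by
        rcases le_or_gt t (s k) with h | h
        · rw [hp'.eq_left t h, (hp k).eq_left t h]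
        · have h' : s' k ≤ t := by
            by_contra! h'
            exact ht ⟨h, h'⟩
          rw [hp'.eq_right t h', (hp k).eq_right t h']
      refine ⟨Function.update p k p', fun i => ?_, fun i hi j hij t ht => ?_⟩
      · by_cases h : i = k
        · subst h
          simpa using hp'
        · simpa [h] using hp i
      · by_cases h : i = k
        · subst h
          rw [Function.update_self, Function.update_of_ne hij.symm]
          exact hne j t ht
        · have hiS : i ∈ S := (Finset.mem_insert.1 hi).resolve_left h
          rw [Function.update_of_ne h]
          by_cases hj : j = k
          · subst hj
            rw [Function.update_self]
            -- The new curve avoids the old ones during its own control phase and is unchanged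
            -- elsewhere, so earlier separations persist.
            by_cases htk : t ∈ Set.Ioo (s j) (s' j)
            · exact (hne i t htk).symm
            · rw [hout t htk]
              exact hS i hiS j hij t ht
          · rw [Function.update_of_ne hj]
            exact hS i hiS j hij t ht
  obtain ⟨p, hp, hne⟩ := key Finset.univ
  have hT0 : ∀ i, entranceTime v ω (x i) < T := fun i =>
    lt_of_le_of_lt (by linarith [backwardEntranceTime_nonneg (v := v) (ω := ω) (y i)]) (hT i)
  refine ⟨p, hp, fun i j hij t => ?_⟩
  rcases le_or_gt t (s i) with hi | hi
  · rcases le_or_gt t (s j) with hj | hj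
    · rw [(hp i).eq_left t hi, (hp j).eq_left t hj]
      exact fun h => hij (hxi (hv.flow_injective t h))
    · rcases lt_or_ge t (s' j) with hj' | hj'
      · exact (hne j (Finset.mem_univ j) i hij.symm t ⟨hj, hj'⟩).symm
      · rw [(hp i).eq_left t hi, (hp j).eq_right t hj']
        exact hs.flow_ne hv hω hx hT0 hi hj'
  · rcases lt_or_ge t (s' i) with hi' | hi'
    · exact hne i (Finset.mem_univ i) j hij t ⟨hi, hi'⟩
    · rw [(hp i).eq_right t hi']
      rcases le_or_gt t (s j) with hj | hj
      · rw [(hp j).eq_left t hj]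
        exact (hs.flow_ne hv hω hx hT0 hj hi').symm
      · rcases lt_or_ge t (s' j) with hj' | hj'
        · rw [← (hp i).eq_right t hi']
          exact (hne j (Finset.mem_univ j) i hij.symm t ⟨hj, hj'⟩).symm
        · rw [(hp j).eq_right t hj']
          exact fun h => hij (hyi (hv.flow_injective _ h))

end Curves

/-! ### Ordered families of scalar curves. -/

section Selection

/-- A strictly increasing assignment on part of `Fin N` extends to all of `Fin N`, with values in
`(a, b)` on the remaining indices. -/
theorem exists_strictMono_extension {N : ℕ} (M : Fin N → Prop) (val : Fin N → ℝ) {a b : ℝ}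
    (hab : a < b) (h1 : ∀ i j, i < j → ¬M i → ¬M j → val i < val j)
    (h2 : ∀ i j, i < j → ¬M i → M j → val i < b) (h3 : ∀ i j, i < j → M i → ¬M j → a < val j) :
    ∃ z : Fin N → ℝ, StrictMono z ∧ (∀ i, ¬M i → z i = val i) ∧
      ∀ i, M i → a < z i ∧ z i < b := by
  classical
  let A : Fin N → Finset ℝ := fun j =>
    insert a ((Finset.univ.filter fun i => i < j ∧ ¬M i).image val)
  let B : Fin N → Finset ℝ := fun j =>
    insert b ((Finset.univ.filter fun i => j < i ∧ ¬M i).image val)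
  have hA : ∀ j y, y ∈ A j ↔ y = a ∨ ∃ i, (i < j ∧ ¬M i) ∧ val i = y := fun j y => by simp [A]
  have hB : ∀ j y, y ∈ B j ↔ y = b ∨ ∃ i, (j < i ∧ ¬M i) ∧ val i = y := fun j y => by simp [B]
  have hAn : ∀ j, (A j).Nonempty := fun j => ⟨a, (hA j a).2 (Or.inl rfl)⟩
  have hBn : ∀ j, (B j).Nonempty := fun j => ⟨b, (hB j b).2 (Or.inl rfl)⟩
  let L : Fin N → ℝ := fun j => (A j).max' (hAn j)
  let U : Fin N → ℝ := fun j => (B j).min' (hBn j)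
  have hLU : ∀ j, M j → L j < U j := fun j hj => by
    refine (Finset.max'_lt_iff _ _).2 fun y hy => (Finset.lt_min'_iff _ _).2 fun y' hy' => ?_
    rcases (hA j y).1 hy with rfl | ⟨i, ⟨hij, hi⟩, rfl⟩ <;>
      rcases (hB j y').1 hy' with rfl | ⟨k, ⟨hjk, hk⟩, rfl⟩
    · exact hab
    · exact h3 j k hjk hj hk
    · exact h2 i j hij hi hj
    · exact h1 i k (hij.trans hjk) hi hk
  have hLm : ∀ j k, j ≤ k → L j ≤ L k := fun j k hjk => by
    refine Finset.max'_subset _ fun y hy => ?_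
    rcases (hA j y).1 hy with h | ⟨i, ⟨hij, hi⟩, h⟩
    · exact (hA k y).2 (Or.inl h)
    · exact (hA k y).2 (Or.inr ⟨i, ⟨hij.trans_le hjk, hi⟩, h⟩)
  have hUm : ∀ j k, j ≤ k → U j ≤ U k := fun j k hjk => by
    refine Finset.min'_subset _ fun y hy => ?_
    rcases (hB k y).1 hy with h | ⟨i, ⟨hij, hi⟩, h⟩
    · exact (hB j y).2 (Or.inl h)
    · exact (hB j y).2 (Or.inr ⟨i, ⟨hjk.trans_lt hij, hi⟩, h⟩)
  have hLa : ∀ j, a ≤ L j := fun j => Finset.le_max' _ _ ((hA j a).2 (Or.inl rfl))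
  have hUb : ∀ j, U j ≤ b := fun j => Finset.min'_le _ _ ((hB j b).2 (Or.inl rfl))
  have hLv : ∀ i j, i < j → ¬M i → val i ≤ L j := fun i j hij hi =>
    Finset.le_max' _ _ ((hA j _).2 (Or.inr ⟨i, ⟨hij, hi⟩, rfl⟩))
  have hUv : ∀ i j, i < j → ¬M j → U i ≤ val j := fun i j hij hj =>
    Finset.min'_le _ _ ((hB i _).2 (Or.inr ⟨j, ⟨hij, hj⟩, rfl⟩))
  let c : Fin N → ℝ := fun j => ((j : ℝ) + 1) / (N + 1)
  have hN : (0 : ℝ) < N + 1 := by positivity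
  have hc0 : ∀ j, 0 < c j := fun j => div_pos (by positivity) hN
  have hc1 : ∀ j, c j < 1 := fun j => by
    rw [div_lt_one hN]
    have : (j : ℝ) < N := by exact_mod_cast j.2
    linarith
  have hcm : ∀ i j, i < j → c i < c j := fun i j hij => by
    refine div_lt_div_of_pos_right ?_ hN
    have : (i : ℝ) < j := by exact_mod_cast hij
    linarith
  let m : Fin N → ℝ := fun j => (1 - c j) * L j + c j * U j
  have hmL : ∀ j, M j → L j < m j := fun j hj => by
    have := mul_pos (hc0 j) (sub_pos.2 (hLU j hj))
    simp only [m]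
    linarith
  have hmU : ∀ j, M j → m j < U j := fun j hj => by
    have := mul_pos (sub_pos.2 (hc1 j)) (sub_pos.2 (hLU j hj))
    simp only [m]
    linarith
  refine ⟨fun j => if M j then m j else val j, fun i j hij => ?_, fun i hi => by simp [hi],
    fun i hi => by
      simp only [hi, if_true]
      exact ⟨(hLa i).trans_lt (hmL i hi), (hmU i hi).trans_le (hUb i)⟩⟩
  by_cases hi : M i <;> by_cases hj : M j <;> simp only [hi, hj, if_true, if_false]
  · have e1 := mul_pos (sub_pos.2 (hcm i j hij)) (sub_pos.2 (hLU i hi))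
    have e2 := mul_nonneg (sub_pos.2 (hc1 j)).le (sub_nonneg.2 (hLm i j hij.le))
    have e3 := mul_nonneg (hc0 j).le (sub_nonneg.2 (hUm i j hij.le))
    simp only [m]
    linarith
  · exact (hmU i hi).trans_le (hUv i j hij hj)
  · exact (hLv i j hij hi).trans_lt (hmL j hj)
  · exact h1 i j hij hi hj

open scoped Manifold ContDiff in
/-- Ordered families of scalar `C¹` curves that switch from `f i` to `g i` inside `(a, b)`. -/
theorem exists_strictMono_switch {N : ℕ} {f g : Fin N → ℝ → ℝ} {s s' : Fin N → ℝ} {a b : ℝ}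
    (hab : a < b) (hf : ∀ i, ContDiff ℝ 1 (f i)) (hg : ∀ i, ContDiff ℝ 1 (g i))
    (hss : ∀ i, s i < s' i)
    (hfs : ∀ i, f i (s i) ∈ Set.Ioo a b) (hgs : ∀ i, g i (s' i) ∈ Set.Ioo a b)
    (hff : ∀ i j t, i < j → f i t < f j t) (hgg : ∀ i j t, i < j → g i t < g j t)
    (hfg : ∀ i j t, i < j → t ≤ s i → s' j ≤ t → f i t < g j t)
    (hgf : ∀ i j t, i < j → s' i ≤ t → t ≤ s j → g i t < f j t)
    (hfm : ∀ i j t, i < j → t ≤ s i → s j < t → t < s' j → f i t < b)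
    (hmf : ∀ i j t, i < j → s i < t → t < s' i → t ≤ s j → a < f j t)
    (hgm : ∀ i j t, i < j → s' i ≤ t → s j < t → t < s' j → g i t < b)
    (hmg : ∀ i j t, i < j → s i < t → t < s' i → s' j ≤ t → a < g j t) :
    ∃ p : Fin N → ℝ → ℝ, (∀ i, ContDiff ℝ 1 (p i)) ∧ (∀ i, ∀ t ≤ s i, p i t = f i t) ∧
      (∀ i t, s' i ≤ t → p i t = g i t) ∧ (∀ i, ∀ t ∈ Set.Icc (s i) (s' i), p i t ∈ Set.Ioo a b) ∧
      ∀ t, StrictMono fun i => p i t := by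
  classical
  -- Order, prescribed values and the bounds are convex constraints, so local `C¹` selections can be
  -- averaged by a partition of unity.
  let C : ℝ → Set (Fin N → ℝ) := fun t => {z | StrictMono z ∧ ∀ i, (t ≤ s i → z i = f i t) ∧
    (s' i ≤ t → z i = g i t) ∧ (s i ≤ t → t ≤ s' i → z i ∈ Set.Ioo a b)}
  have hconv : ∀ t, Convex ℝ (C t) := by
    rintro t z ⟨hz, hz'⟩ w ⟨hw, hw'⟩ α β hα hβ hαβ
    refine ⟨fun i j hij => ?_, fun i => ⟨fun h => ?_, fun h => ?_, fun h h' => ?_⟩⟩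
    · simp only [Pi.add_apply, Pi.smul_apply, smul_eq_mul]
      rcases hα.eq_or_lt with rfl | hα
      · have : β = 1 := by linarith
        subst this
        simpa using hw hij
      · have e1 := mul_lt_mul_of_pos_left (hz hij) hα
        have e2 := mul_le_mul_of_nonneg_left (hw hij).le hβ
        linarith
    · simp only [Pi.add_apply, Pi.smul_apply, smul_eq_mul]
      rw [(hz' i).1 h, (hw' i).1 h, ← add_mul, hαβ, one_mul]
    · simp only [Pi.add_apply, Pi.smul_apply, smul_eq_mul]
      rw [(hz' i).2.1 h, (hw' i).2.1 h, ← add_mul, hαβ, one_mul]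
    · exact convex_Ioo a b ((hz' i).2.2 h h') ((hw' i).2.2 h h') hα hβ hαβ
  have hloc : ∀ t₀ : ℝ, ∃ U ∈ nhds t₀, ∃ q : ℝ → Fin N → ℝ,
      ContMDiffOn 𝓘(ℝ, ℝ) 𝓘(ℝ, Fin N → ℝ) ((1 : ℕ∞) : ℕ∞ω) q U ∧ ∀ t ∈ U, q t ∈ C t := by
    intro t₀
    obtain ⟨z, hz, hzv, hzm⟩ := exists_strictMono_extension
      (fun i => s i < t₀ ∧ t₀ < s' i) (fun i => if t₀ ≤ s i then f i t₀ else g i t₀) hab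
      (fun i j hij hi hj => by
        by_cases h1 : t₀ ≤ s i <;> by_cases h2 : t₀ ≤ s j <;> simp only [h1, h2, if_true, if_false]
        · exact hff i j t₀ hij
        · exact hfg i j t₀ hij h1 (by push Not at hj h2; exact hj h2)
        · exact hgf i j t₀ hij (by push Not at hi h1; exact hi h1) h2
        · exact hgg i j t₀ hij)
      (fun i j hij hi hj => by
        by_cases h1 : t₀ ≤ s i <;> simp only [h1, if_true, if_false]
        · exact hfm i j t₀ hij h1 hj.1 hj.2
        · exact hgm i j t₀ hij (by push Not at hi h1; exact hi h1) hj.1 hj.2)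
      (fun i j hij hi hj => by
        by_cases h1 : t₀ ≤ s j <;> simp only [h1, if_true, if_false]
        · exact hmf i j t₀ hij hi.1 hi.2 h1
        · exact hmg i j t₀ hij hi.1 hi.2 (by push Not at hj h1; exact hj h1))
    -- Near `t₀` an index follows `f` before or at its entrance, `g` from its exit on, and is
    -- constant in between. Strict order and membership in `(a, b)` persist by continuity.
    let q : ℝ → Fin N → ℝ := fun t i =>
      if t₀ ≤ s i then f i t else if s' i ≤ t₀ then g i t else z i
    have hq : ContDiff ℝ 1 q := contDiff_pi.2 fun i => by
      simp only [q]
      split_ifs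
      exacts [hf i, hg i, contDiff_const]
    have hq0 : q t₀ = z := by
      funext i
      simp only [q]
      split_ifs with h1 h2
      · rw [hzv i fun h => h.1.not_ge h1, if_pos h1]
      · rw [hzv i fun h => h.2.not_ge h2, if_neg h1]
      · rfl
    have hqc : ∀ i, Continuous fun t => q t i := fun i => (continuous_apply i).comp hq.continuous
    have hev1 : ∀ᶠ t in nhds t₀, ∀ i j, i < j → q t i < q t j :=
      Filter.eventually_all.2 fun i => Filter.eventually_all.2 fun j =>
        Filter.eventually_imp_distrib_left.2 fun hij =>
          (hqc i).continuousAt.eventually_lt (hqc j).continuousAt (by rw [hq0]; exact hz hij)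
    have hev2 : ∀ᶠ t in nhds t₀, ∀ i, (t ≤ s i → q t i = f i t) ∧ (s' i ≤ t → q t i = g i t) ∧
        (s i ≤ t → t ≤ s' i → q t i ∈ Set.Ioo a b) := by
      refine Filter.eventually_all.2 fun i => ?_
      have hopen : q t₀ i ∈ Set.Ioo a b → ∀ᶠ t in nhds t₀, q t i ∈ Set.Ioo a b := fun h =>
        (hqc i).continuousAt.eventually (isOpen_Ioo.mem_nhds h)
      rcases lt_trichotomy t₀ (s i) with h | h | h
      · filter_upwards [Iio_mem_nhds h] with t ht
        have ht : t < s i := ht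
        refine ⟨fun _ => by simp [q, h.le], fun h' => ?_, fun h' => absurd ht h'.not_gt⟩
        linarith [hss i]
      · have hin : q t₀ i ∈ Set.Ioo a b := by
          simp only [q, h.le, if_true]
          rw [h]
          exact hfs i
        filter_upwards [hopen hin, Iio_mem_nhds (h.trans_lt (hss i))] with t ht ht'
        have ht' : t < s' i := ht'
        exact ⟨fun _ => by simp [q, h.le], fun h' => absurd ht' h'.not_gt, fun _ _ => ht⟩
      · rcases lt_trichotomy t₀ (s' i) with h' | h' | h'
        · have hin : q t₀ i ∈ Set.Ioo a b := by
            rw [hq0]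
            exact hzm i ⟨h, h'⟩
          filter_upwards [hopen hin, Ioo_mem_nhds h h'] with t ht ht'
          exact ⟨fun h => absurd ht'.1 h.not_gt, fun h => absurd ht'.2 h.not_gt, fun _ _ => ht⟩
        · have hin : q t₀ i ∈ Set.Ioo a b := by
            simp only [q, h.not_ge, h'.ge, if_true, if_false]
            rw [h']
            exact hgs i
          filter_upwards [hopen hin, Ioi_mem_nhds h] with t ht ht'
          have ht' : s i < t := ht'
          exact ⟨fun h => absurd ht' h.not_gt, fun _ => by simp [q, h.not_ge, h'.ge],
            fun _ _ => ht⟩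
        · filter_upwards [Ioi_mem_nhds h'] with t ht
          have ht : s' i < t := ht
          refine ⟨fun h1 => ?_, fun _ => by simp [q, h.not_ge, h'.le],
            fun _ h1 => absurd ht h1.not_gt⟩
          linarith [hss i]
    refine ⟨_, hev1.and hev2, q, ?_, fun t ht => ⟨fun i j hij => ht.1 i j hij, ht.2⟩⟩
    exact (contMDiff_iff_contDiff.2 (by exact_mod_cast hq)).contMDiffOn
  obtain ⟨p, hp⟩ := exists_contMDiffMap_forall_mem_convex_of_local 𝓘(ℝ, ℝ) (n := 1) hconv hloc
  have hpc : ContDiff ℝ 1 (p : ℝ → Fin N → ℝ) := by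
    have := contMDiff_iff_contDiff.1 p.contMDiff
    exact_mod_cast this
  exact ⟨fun i t => p t i, fun i => contDiff_pi.1 hpc i, fun i t => ((hp t).2 i).1,
    fun i t => ((hp t).2 i).2.1, fun i t ht => ((hp t).2 i).2.2 ht.1 ht.2, fun t => (hp t).1⟩

end Selection

/-! ### The one-dimensional case. -/

section Line

variable {v : State 1 → State 1} {ω : Set (State 1)}

theorem state_one_ext {x y : State 1} (h : x 0 = y 0) : x = y := by
  ext i
  rwa [Subsingleton.elim i 0]

theorem exists_Ioo_of_isConnected (hωo : IsOpen ω) (hωb : Bornology.IsBounded ω)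
    (hωc : IsConnected ω) :
    ∃ a b : ℝ, a < b ∧ ∀ x, x ∈ ω ↔ a < x 0 ∧ x 0 < b := by
  let e : State 1 ≃L[ℝ] ℝ := (EuclideanSpace.equiv (Fin 1) ℝ).trans
    (ContinuousLinearEquiv.funUnique (Fin 1) ℝ ℝ)
  have he : ∀ x, e x = x 0 := fun x => rfl
  set J : Set ℝ := e '' ω with hJ
  have hJo : IsOpen J := e.toHomeomorph.isOpenMap _ hωo
  have hJb : Bornology.IsBounded J := e.lipschitz.isBounded_image hωb
  have hJc : IsConnected J := hωc.image _ e.continuous.continuousOn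
  have hmem : ∀ x, x ∈ ω ↔ e x ∈ J := fun x => (e.injective.mem_set_image).symm
  have hsub := hJc.Ioo_csInf_csSup_subset hJb.bddBelow hJb.bddAbove
  have hinf : ∀ r ∈ J, sInf J < r := fun r hr => by
    refine lt_of_le_of_ne (csInf_le hJb.bddBelow hr) fun h => ?_
    obtain ⟨ε, hε, hball⟩ := Metric.isOpen_iff.1 hJo r hr
    have h1 : r - ε / 2 ∈ J := hball (by
      rw [Metric.mem_ball, Real.dist_eq, sub_sub_cancel_left, abs_neg, abs_of_pos (by linarith)]
      linarith)
    linarith [csInf_le hJb.bddBelow h1]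
  have hsup : ∀ r ∈ J, r < sSup J := fun r hr => by
    refine lt_of_le_of_ne (le_csSup hJb.bddAbove hr) fun h => ?_
    obtain ⟨ε, hε, hball⟩ := Metric.isOpen_iff.1 hJo r hr
    have h1 : r + ε / 2 ∈ J := hball (by
      rw [Metric.mem_ball, Real.dist_eq, add_sub_cancel_left, abs_of_pos (by linarith)]
      linarith)
    linarith [le_csSup hJb.bddAbove h1]
  obtain ⟨r, hr⟩ := hJc.nonempty
  refine ⟨sInf J, sSup J, (hinf r hr).trans (hsup r hr), fun x => ?_⟩
  rw [hmem, ← he]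
  exact ⟨fun h => ⟨hinf _ h, hsup _ h⟩, fun h => hsub h⟩

namespace GoodField

variable (hv : GoodField v)
include hv

theorem continuous_flow_coord (x : State 1) : Continuous fun t => flow v t x 0 :=
  (by fun_prop : Continuous fun x : State 1 => x 0).comp (hv.continuous_flow x)

theorem contDiff_flow_coord (x : State 1) : ContDiff ℝ 1 fun t => flow v t x 0 :=
  contDiff_euclidean.1 (hv.contDiff_flow x) 0

/-- Orbits on the line cannot exchange order without meeting, and the flow is injective. -/
theorem flow_lt_flow {x y : State 1} (h : x 0 < y 0) (t : ℝ) : flow v t x 0 < flow v t y 0 := by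
  by_contra! ht
  have hc : Continuous fun t => flow v t y 0 - flow v t x 0 :=
    (hv.continuous_flow_coord y).sub (hv.continuous_flow_coord x)
  obtain ⟨r, hr⟩ := mem_range_of_exists_le_of_exists_ge hc (c := 0) ⟨t, by linarith⟩
    ⟨0, by rw [hv.flow_zero, hv.flow_zero]; linarith⟩
  have h1 : flow v r y = flow v r x := state_one_ext (sub_eq_zero.1 hr)
  rw [hv.flow_injective r h1] at h
  exact lt_irrefl _ h

theorem flow_le_flow {x y : State 1} (h : x 0 ≤ y 0) (t : ℝ) : flow v t x 0 ≤ flow v t y 0 := by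
  rcases h.lt_or_eq with h | h
  · exact (hv.flow_lt_flow h t).le
  · rw [state_one_ext h]

theorem lt_of_flow_lt {x y : State 1} {t : ℝ} (h : flow v t x 0 < flow v t y 0) : x 0 < y 0 := by
  by_contra! h'
  exact (hv.flow_le_flow h' t).not_gt h

/-- On the line every orbit is monotone. -/
theorem monotone_or_antitone_flow (x : State 1) :
    Monotone (fun t => flow v t x 0) ∨ Antitone fun t => flow v t x 0 := by
  have hd : ∀ t, HasDerivAt (fun t => flow v t x 0) (v (flow v t x) 0) t := fun t =>
    ((EuclideanSpace.proj (𝕜 := ℝ) (0 : Fin 1)).hasFDerivAt.comp_hasDerivAt t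
      (hv.hasDerivAt_flow x t) :)
  have hc : Continuous fun t => v (flow v t x) 0 :=
    (by fun_prop : Continuous fun x : State 1 => x 0).comp
      (hv.continuous.comp (hv.continuous_flow x))
  by_cases h0 : ∃ r, v (flow v r x) 0 = 0
  · obtain ⟨r, hr⟩ := h0
    have hvr : v (flow v r x) = 0 := state_one_ext hr
    have hconst : ∀ t, flow v r x = flow v t x :=
      hv.eq_flow (γ := fun _ => flow v r x) (a := r)
        (fun t => by rw [hvr]; exact hasDerivAt_const t _) rfl
    left
    intro t t' _
    simp only
    rw [← hconst t, ← hconst t']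
  · push Not at h0
    by_cases hpos : ∃ t, 0 < v (flow v t x) 0
    · left
      refine monotone_of_deriv_nonneg (fun t => (hd t).differentiableAt) fun t => ?_
      rw [(hd t).deriv]
      by_contra! hneg
      obtain ⟨r, hr⟩ := mem_range_of_exists_le_of_exists_ge hc (c := 0) ⟨t, hneg.le⟩
        (hpos.imp fun _ h => h.le)
      exact h0 r hr
    · push Not at hpos
      right
      refine antitone_of_deriv_nonpos (fun t => (hd t).differentiableAt) fun t => ?_
      rw [(hd t).deriv]
      exact hpos t

theorem flow_lt_of_between (x : State 1) {b r₁ r₂ r₃ : ℝ} (h₁ : r₁ ≤ r₂) (h₂ : r₂ ≤ r₃)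
    (hb₁ : flow v r₁ x 0 < b) (hb₃ : flow v r₃ x 0 < b) : flow v r₂ x 0 < b := by
  rcases hv.monotone_or_antitone_flow x with h | h
  · exact (h h₂).trans_lt hb₃
  · exact (h h₁).trans_lt hb₁

theorem lt_flow_of_between (x : State 1) {b r₁ r₂ r₃ : ℝ} (h₁ : r₁ ≤ r₂) (h₂ : r₂ ≤ r₃)
    (hb₁ : b < flow v r₁ x 0) (hb₃ : b < flow v r₃ x 0) : b < flow v r₂ x 0 := by
  rcases hv.monotone_or_antitone_flow x with h | h
  · exact hb₁.trans_le (h h₁)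
  · exact hb₃.trans_le (h h₂)

/-- No point of the line is left on the same side both forward and backward in time. -/
theorem not_lt_flow_and_lt_flow {x y : State 1} {c s r : ℝ} (hs : 0 < s) (hr : 0 < r)
    (hx : x 0 ≤ c) (hxs : c < flow v s x 0) (hy : y 0 ≤ c) (hyr : c < flow v (-r) y 0) : False := by
  obtain ⟨q, hq, hqc⟩ := intermediate_value_Icc hs.le (hv.continuous_flow_coord x).continuousOn
    (show c ∈ Set.Icc (flow v 0 x 0) (flow v s x 0) by
      rw [hv.flow_zero]
      exact ⟨hx, hxs.le⟩)
  obtain ⟨q', hq', hqc'⟩ := intermediate_value_Icc' (show -r ≤ 0 by linarith)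
    (hv.continuous_flow_coord y).continuousOn
    (show c ∈ Set.Icc (flow v 0 y 0) (flow v (-r) y 0) by
      rw [hv.flow_zero]
      exact ⟨hy, hyr.le⟩)
  simp only at hqc hqc'
  -- Both orbits pass through `c`, hence form one orbit. It would lie above `c` both before and
  -- after that moment, against monotonicity.
  have heq : flow v q x = flow v q' y := state_one_ext (hqc.trans hqc'.symm)
  have h1 : c < flow v (s - q) (flow v q x) 0 := by rwa [hv.flow_flow, sub_add_cancel]
  have h2 : c < flow v (-r - q') (flow v q x) 0 := by rwa [heq, hv.flow_flow, sub_add_cancel]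
  have h3 := hv.lt_flow_of_between (flow v q x) (r₁ := -r - q') (r₂ := 0) (r₃ := s - q)
    (by linarith [hq'.1]) (by linarith [hq.2]) h2 h1
  rw [hv.flow_zero] at h3
  linarith

theorem not_flow_lt_and_flow_lt {x y : State 1} {c s r : ℝ} (hs : 0 < s) (hr : 0 < r)
    (hx : c ≤ x 0) (hxs : flow v s x 0 < c) (hy : c ≤ y 0) (hyr : flow v (-r) y 0 < c) : False := by
  obtain ⟨q, hq, hqc⟩ := intermediate_value_Icc' hs.le (hv.continuous_flow_coord x).continuousOn
    (show c ∈ Set.Icc (flow v s x 0) (flow v 0 x 0) by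
      rw [hv.flow_zero]
      exact ⟨hxs.le, hx⟩)
  obtain ⟨q', hq', hqc'⟩ := intermediate_value_Icc (show -r ≤ 0 by linarith)
    (hv.continuous_flow_coord y).continuousOn
    (show c ∈ Set.Icc (flow v (-r) y 0) (flow v 0 y 0) by
      rw [hv.flow_zero]
      exact ⟨hyr.le, hy⟩)
  simp only at hqc hqc'
  have heq : flow v q x = flow v q' y := state_one_ext (hqc.trans hqc'.symm)
  have h1 : flow v (s - q) (flow v q x) 0 < c := by rwa [hv.flow_flow, sub_add_cancel]
  have h2 : flow v (-r - q') (flow v q x) 0 < c := by rwa [heq, hv.flow_flow, sub_add_cancel]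
  have h3 := hv.flow_lt_of_between (flow v q x) (r₁ := -r - q') (r₂ := 0) (r₃ := s - q)
    (by linarith [hq'.1]) (by linarith [hq.2]) h2 h1
  rw [hv.flow_zero] at h3
  linarith

end GoodField

/-- A curve starting at or below `c` takes no longer to hit a set above `c` than a curve below
it. -/
theorem sInf_hitting_le_of_le {φ ψ : ℝ → State 1} (hφ : Continuous φ)
    (hle : ∀ t, ψ t 0 ≤ φ t 0) {c : ℝ} (h0 : φ 0 0 ≤ c) (hω : ∀ z ∈ ω, c < z 0)
    (hex : ∃ t : ℝ, 0 < t ∧ ψ t ∈ ω) :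
    sInf {t : ℝ | 0 ≤ t ∧ φ t ∈ ω} ≤ sInf {t : ℝ | 0 ≤ t ∧ ψ t ∈ ω} := by
  obtain ⟨t, ht0, ht⟩ := hex
  have hne : {t : ℝ | 0 ≤ t ∧ ψ t ∈ ω}.Nonempty := ⟨t, ht0.le, ht⟩
  refine le_csInf hne fun s hs => ?_
  have hc : Continuous fun t => φ t 0 := (by fun_prop : Continuous fun x : State 1 => x 0).comp hφ
  obtain ⟨r, hr, hrs⟩ := intermediate_value_Icc hs.1 hc.continuousOn
    (show ψ s 0 ∈ Set.Icc (φ 0 0) (φ s 0) from ⟨h0.trans (hω _ hs.2).le, hle s⟩)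
  have heq : φ r = ψ s := state_one_ext hrs
  exact (sInf_hitting_le hr.1 (by rw [heq]; exact hs.2)).trans hr.2

theorem sInf_hitting_le_of_ge {φ ψ : ℝ → State 1} (hφ : Continuous φ)
    (hle : ∀ t, φ t 0 ≤ ψ t 0) {c : ℝ} (h0 : c ≤ φ 0 0) (hω : ∀ z ∈ ω, z 0 < c)
    (hex : ∃ t : ℝ, 0 < t ∧ ψ t ∈ ω) :
    sInf {t : ℝ | 0 ≤ t ∧ φ t ∈ ω} ≤ sInf {t : ℝ | 0 ≤ t ∧ ψ t ∈ ω} := by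
  obtain ⟨t, ht0, ht⟩ := hex
  have hne : {t : ℝ | 0 ≤ t ∧ ψ t ∈ ω}.Nonempty := ⟨t, ht0.le, ht⟩
  refine le_csInf hne fun s hs => ?_
  have hc : Continuous fun t => φ t 0 := (by fun_prop : Continuous fun x : State 1 => x 0).comp hφ
  obtain ⟨r, hr, hrs⟩ := intermediate_value_Icc' hs.1 hc.continuousOn
    (show ψ s 0 ∈ Set.Icc (φ s 0) (φ 0 0) from ⟨hle s, (hω _ hs.2).le.trans h0⟩)
  have heq : φ r = ψ s := state_one_ext hrs
  exact (sInf_hitting_le hr.1 (by rw [heq]; exact hs.2)).trans hr.2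

/-- On the line, matching agents and targets by their position preserves the bound on the sum of
the entrance times. -/
theorem entranceTime_add_lt_of_sorted (hv : GoodField v) {a b : ℝ}
    (hω : ∀ x, x ∈ ω ↔ a < x 0 ∧ x 0 < b) {N : ℕ} {x y : Fin N → State 1}
    (hx : ∀ i, ∃ t : ℝ, 0 < t ∧ flow v t (x i) ∈ ω)
    (hy : ∀ i, ∃ t : ℝ, 0 < t ∧ flow v (-t) (y i) ∈ ω)
    {T : ℝ} (hT : ∀ i, entranceTime v ω (x i) + backwardEntranceTime v ω (y i) < T)
    {σ τ : Equiv.Perm (Fin N)} (hσ : Monotone fun i => x (σ i) 0)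
    (hτ : Monotone fun i => y (τ i) 0) (k : Fin N) :
    entranceTime v ω (x (σ k)) + backwardEntranceTime v ω (y (τ k)) < T := by
  by_contra! hk
  -- It suffices to find one original pair whose two times are both at least those of rank `k`.
  have hle : ∀ i, entranceTime v ω (x (σ k)) ≤ entranceTime v ω (x i) →
      backwardEntranceTime v ω (y (τ k)) ≤ backwardEntranceTime v ω (y i) → False :=
    fun i h1 h2 => by linarith [hT i]
  have hx0 : x (σ k) ∉ ω := fun h => by
    have h1 := entranceTime_le (v := v) (ω := ω) (x := x (σ k)) le_rfl (by rwa [hv.flow_zero])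
    linarith [hT (τ k), entranceTime_nonneg (v := v) (ω := ω) (x (τ k))]
  have hy0 : y (τ k) ∉ ω := fun h => by
    have h1 := backwardEntranceTime_le (v := v) (ω := ω) (x := y (τ k)) le_rfl
      (by rwa [neg_zero, hv.flow_zero])
    linarith [hT (σ k), backwardEntranceTime_nonneg (v := v) (ω := ω) (y (σ k))]
  have hlo : ∀ z ∈ ω, a < z 0 := fun z hz => ((hω z).1 hz).1
  have hhi : ∀ z ∈ ω, z 0 < b := fun z hz => ((hω z).1 hz).2
  have hside : ∀ z, z ∉ ω → z 0 ≤ a ∨ b ≤ z 0 := fun z hz => by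
    by_contra! h
    exact hz ((hω z).2 h)
  have hcb : ∀ z, Continuous fun t => flow v (-t) z := fun z =>
    (hv.continuous_flow z).comp continuous_neg
  obtain ⟨s, hs0, hs⟩ := hx (σ k)
  obtain ⟨r, hr0, hr⟩ := hy (τ k)
  rcases hside _ hx0 with h1 | h1 <;> rcases hside _ hy0 with h2 | h2
  · exact hv.not_lt_flow_and_lt_flow hs0 hr0 h1 (hlo _ hs) h2 (hlo _ hr)
  -- With the agent left of `ω` and the target right of it, agents of lower rank and targets of
  -- higher rank have times at least as large. By pigeonhole some original pair has both properties.
  · obtain ⟨i, _, hi1, hi2⟩ := exists_le_and_le τ.symm σ.symm (R := 0) (k := k) (by omega)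
    refine hle i ?_ ?_
    · refine sInf_hitting_le_of_le (hv.continuous_flow _) (fun t => hv.flow_le_flow ?_ t)
        (by rw [hv.flow_zero]; exact h1) hlo (hx i)
      simpa using hσ (show σ.symm i ≤ k from hi2)
    · refine sInf_hitting_le_of_ge (hcb _) (fun t => hv.flow_le_flow ?_ (-t))
        (by rw [neg_zero, hv.flow_zero]; exact h2) hhi (hy i)
      simpa using hτ (show k ≤ τ.symm i from hi1)
  · obtain ⟨i, _, hi1, hi2⟩ := exists_le_and_le σ.symm τ.symm (R := 0) (k := k) (by omega)
    refine hle i ?_ ?_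
    · refine sInf_hitting_le_of_ge (hv.continuous_flow _) (fun t => hv.flow_le_flow ?_ t)
        (by rw [hv.flow_zero]; exact h1) hhi (hx i)
      simpa using hσ (show k ≤ σ.symm i from hi1)
    · refine sInf_hitting_le_of_le (hcb _) (fun t => hv.flow_le_flow ?_ (-t))
        (by rw [neg_zero, hv.flow_zero]; exact h2) hlo (hy i)
      simpa using hτ (show τ.symm i ≤ k from hi2)
  · exact hv.not_flow_lt_and_flow_lt hs0 hr0 h1 (hhi _ hs) h2 (hhi _ hr)

/-- Reduces to `exists_strictMono_switch`. Its order conditions hold because free orbits keep their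
order and are monotone, hence cannot leave the interval `(a, b)` and return. -/
theorem exists_disjoint_steeringCurves_of_strictMono (hv : GoodField v) {a b : ℝ} (hab : a < b)
    (hω : ∀ x, x ∈ ω ↔ a < x 0 ∧ x 0 < b) {N : ℕ} {x y : Fin N → State 1}
    (hxm : StrictMono fun i => x i 0) (hym : StrictMono fun i => y i 0)
    {T : ℝ} (hT : ∀ i, entranceTime v ω (x i) + backwardEntranceTime v ω (y i) < T)
    {s s' : Fin N → ℝ} (hs : SteeringTimes v ω x y T s s') :
    ∃ p : Fin N → ℝ → State 1, (∀ i, SteeringCurve v ω (x i) (y i) T (s i) (s' i) (p i)) ∧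
      ∀ i j, i ≠ j → ∀ t, p i t ≠ p j t := by
  have hss : ∀ i, s i < s' i := fun i => hs.lt i i (hT i)
  have hs0 : ∀ i, 0 ≤ s i := fun i => (entranceTime_nonneg _).trans (hs.lt_left i).le
  have hsT : ∀ i, s' i ≤ T := fun i => by
    linarith [hs.lt_right i, backwardEntranceTime_nonneg (v := v) (ω := ω) (y i)]
  have hml : ∀ i, a < flow v (s i) (x i) 0 ∧ flow v (s i) (x i) 0 < b := fun i =>
    (hω _).1 (hs.mem_left i)
  have hmr : ∀ i, a < flow v (s' i + -T) (y i) 0 ∧ flow v (s' i + -T) (y i) 0 < b := fun i =>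
    (hω _).1 (hs.mem_right i)
  have hff : ∀ i j t, i < j → flow v t (x i) 0 < flow v t (x j) 0 := fun i j t hij =>
    hv.flow_lt_flow (hxm hij) t
  have hgg : ∀ i j t, i < j → flow v (t + -T) (y i) 0 < flow v (t + -T) (y j) 0 :=
    fun i j t hij => hv.flow_lt_flow (hym hij) _
  -- Being in `ω` at time `s' j` would give `t⁰(x i) ≤ s' j`, which forces `s i < s' j`.
  have hsep : ∀ i j t, t ≤ s i → s' j ≤ t → flow v (s' j) (x i) ∉ ω := fun i j t h1 h2 h3 => by
    have h4 := entranceTime_le ((hs0 j).trans (hss j).le) h3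
    have h5 := hs.lt i j (by linarith [hs.lt_right j])
    linarith
  have hcomp : ∀ i j t t', flow v t (x i) 0 ≤ flow v (t + -T) (y j) 0 →
      flow v t' (x i) 0 ≤ flow v (t' + -T) (y j) 0 := fun i j t t' h => by
    rw [← hv.flow_flow] at h ⊢
    by_contra! h'
    exact h.not_gt (hv.flow_lt_flow (hv.lt_of_flow_lt h') t)
  have hcomp' : ∀ i j t t', flow v (t + -T) (y j) 0 ≤ flow v t (x i) 0 →
      flow v (t' + -T) (y j) 0 ≤ flow v t' (x i) 0 := fun i j t t' h => by
    rw [← hv.flow_flow] at h ⊢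
    by_contra! h'
    exact h.not_gt (hv.flow_lt_flow (hv.lt_of_flow_lt h') t)
  obtain ⟨p, hpc, hpl, hpr, hpm, hps⟩ := exists_strictMono_switch
    (f := fun i t => flow v t (x i) 0) (g := fun i t => flow v (t + -T) (y i) 0) hab
    (fun i => hv.contDiff_flow_coord (x i))
    (fun i => (hv.contDiff_flow_coord (y i)).comp (contDiff_id.add contDiff_const))
    hss hml hmr hff hgg
    -- If the order failed at `t`, at time `s' j` the orbit of `x i` would lie above that of `y j`,
    -- hence above `a`, and below `b` by monotonicity; this contradicts `hsep`.
    (fun i j t hij h1 h2 => by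
      by_contra! h
      have e1 : flow v (s' j) (x i) 0 < b := hv.flow_lt_of_between (x i) (r₁ := s j) (r₃ := s i)
        (hss j).le (h2.trans h1) ((hff i j _ hij).trans (hml j).2) (hml i).2
      exact hsep i j t h1 h2
        ((hω _).2 ⟨(hmr j).1.trans_le (hcomp' i j t (s' j) h), e1⟩))
    (fun i j t hij h1 h2 => by
      by_contra! h
      have e1 : a < flow v (s' i) (x j) 0 := hv.lt_flow_of_between (x j) (r₁ := s i) (r₃ := s j)
        (hss i).le (h1.trans h2) ((hml i).1.trans (hff i j _ hij)) (hml j).1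
      exact hsep j i t h2 h1
        ((hω _).2 ⟨e1, (hcomp j i t (s' i) h).trans_lt (hmr i).2⟩))
    (fun i j t hij h1 h2 _ => hv.flow_lt_of_between (x i) h2.le h1
      ((hff i j _ hij).trans (hml j).2) (hml i).2)
    (fun i j t hij h1 _ h3 => hv.lt_flow_of_between (x j) h1.le h3
      ((hml i).1.trans (hff i j _ hij)) (hml j).1)
    (fun i j t hij h1 _ h3 => hv.flow_lt_of_between (y i) (r₁ := s' i + -T) (r₃ := s' j + -T)
      (by linarith) (by linarith) (hmr i).2 ((hgg i j _ hij).trans (hmr j).2))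
    (fun i j t hij _ h2 h3 => hv.lt_flow_of_between (y j) (r₁ := s' j + -T) (r₃ := s' i + -T)
      (by linarith) (by linarith) (hmr j).1 ((hmr i).1.trans (hgg i j _ hij)))
  have hcoord : ∀ r : ℝ, (EuclideanSpace.single (0 : Fin 1) r) 0 = r := fun r => by simp
  refine ⟨fun i t => EuclideanSpace.single 0 (p i t), fun i => ⟨?_, fun t ht => ?_,
    fun t ht => ?_, fun t ht => ?_⟩, fun i j hij t h => ?_⟩
  · refine contDiff_euclidean.2 fun l => ?_
    rw [Subsingleton.elim l 0]
    simpa only [hcoord] using hpc i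
  · exact state_one_ext ((hcoord _).trans (hpl i t ht))
  · exact state_one_ext ((hcoord _).trans (hpr i t ht))
  · rw [hω, hcoord]
    exact hpm i t ht
  · have h1 := congrArg (fun z : State 1 => z 0) h
    simp only [hcoord] at h1
    exact hij ((hps t).injective h1)

end Line

/-! ### Matching and steering at every time beyond `M`. -/

section Steering

variable {d n : ℕ} {v : State d → State d} {ω : Set (State d)}

/-- Agents and targets with compatible entrance times can be matched and joined by disjoint
steering curves. -/
theorem exists_disjoint_steeringCurves (hd : 0 < d) (hv : GoodField v) (hωo : IsOpen ω)
    (hωb : Bornology.IsBounded ω) (hωc : IsConnected ω) {N : ℕ} {x y : Fin N → State d}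
    (hxi : Function.Injective x) (hyi : Function.Injective y)
    (hx : ∀ i, ∃ t : ℝ, 0 < t ∧ flow v t (x i) ∈ ω)
    (hy : ∀ i, ∃ t : ℝ, 0 < t ∧ flow v (-t) (y i) ∈ ω)
    {T : ℝ} (hT : ∀ i, entranceTime v ω (x i) + backwardEntranceTime v ω (y i) < T) :
    ∃ (σ τ : Equiv.Perm (Fin N)) (s s' : Fin N → ℝ) (p : Fin N → ℝ → State d),
      SteeringTimes v ω (x ∘ σ) (y ∘ τ) T s s' ∧
      (∀ i, SteeringCurve v ω (x (σ i)) (y (τ i)) T (s i) (s' i) (p i)) ∧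
      ∀ i j, i ≠ j → ∀ t, p i t ≠ p j t := by
  rcases Nat.lt_or_ge 1 d with hd2 | hd1
  · obtain ⟨s, s', hs⟩ := exists_steeringTimes hv hωo hx hy T
    obtain ⟨p, hp⟩ := exists_disjoint_steeringCurves_of_two_le hd2 hv hωo hωc.isPreconnected
      hxi hyi hx hT hs
    exact ⟨1, 1, s, s', p, hs, hp⟩
  · obtain rfl : d = 1 := by omega
    obtain ⟨a, b, hab, hω⟩ := exists_Ioo_of_isConnected hωo hωb hωc
    set σ := Tuple.sort fun i => x i 0 with hσ
    set τ := Tuple.sort fun i => y i 0 with hτ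
    have hσm : Monotone fun i => x (σ i) 0 := Tuple.monotone_sort fun i => x i 0
    have hτm : Monotone fun i => y (τ i) 0 := Tuple.monotone_sort fun i => y i 0
    obtain ⟨s, s', hs⟩ := exists_steeringTimes (x := x ∘ σ) (y := y ∘ τ) hv hωo
      (fun i => hx _) (fun i => hy _) T
    obtain ⟨p, hp⟩ := exists_disjoint_steeringCurves_of_strictMono hv hab hω
      (hσm.strictMono_of_injective fun i j h => σ.injective (hxi (state_one_ext h)))
      (hτm.strictMono_of_injective fun i j h => τ.injective (hyi (state_one_ext h)))
      (entranceTime_add_lt_of_sorted hv hω hx hy hT hσm hτm) hs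
    exact ⟨σ, τ, s, s', p, hs, hp⟩

theorem exists_perm_extending {N : ℕ} (hN : N ≤ n) {f : Fin N → Fin n}
    (hf : Function.Injective f) :
    ∃ π : Equiv.Perm (Fin n), ∀ i : Fin N, π (Fin.castLE hN i) = f i := by
  classical
  let e : {j // j ∈ Set.range (Fin.castLE hN)} ≃ {j // j ∈ Set.range f} :=
    (Equiv.ofInjective _ (Fin.castLE_injective hN)).symm.trans (Equiv.ofInjective f hf)
  refine ⟨e.extendSubtype, fun i => ?_⟩
  rw [e.extendSubtype_apply_of_mem _ ⟨i, rfl⟩]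
  have h : e (Equiv.ofInjective _ (Fin.castLE_injective hN) i) = Equiv.ofInjective f hf i := by
    rw [Equiv.trans_apply, Equiv.symm_apply_apply]
  exact congrArg Subtype.val h

/-- Steering is possible at every time beyond `maxSum`, with all the steered agents and their
targets having smaller entrance times. -/
theorem exists_steersVia (hd : 0 < d) (hv : GoodField v) (hωo : IsOpen ω)
    (hωb : Bornology.IsBounded ω) (hωc : IsConnected ω) {X₀ X₁ : Fin n → State d}
    (hX₀ : Function.Injective X₀) (hX₁ : Function.Injective X₁)
    (hx : ∀ i, ∃ t : ℝ, 0 < t ∧ flow v t (X₀ i) ∈ ω)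
    (hy : ∀ i, ∃ t : ℝ, 0 < t ∧ flow v (-t) (X₁ i) ∈ ω)
    {γ ε T : ℝ} (hT : maxSum v ω X₀ X₁ ε γ < T) :
    ∃ σ₀ σ₁ : Equiv.Perm (Fin n),
      (∀ i : Fin n, (i : ℕ) < n - leftover n ε γ →
        entranceTime v ω (X₀ (σ₀ i)) < T ∧ backwardEntranceTime v ω (X₁ (σ₁ i)) < T) ∧
      SteersVia v ω X₀ X₁ (leftover n ε γ) T σ₀ σ₁ := by
  set R := leftover n ε γ with hR
  have hN : n - R ≤ n := Nat.sub_le _ _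
  let f : Fin (n - R) → Fin n := Fin.castLE hN
  -- The shift drops the `R` targets with the largest backward times, while `f` drops the `R` agents
  -- that enter last.
  let g : Fin (n - R) → Fin n := fun i => ⟨i + R, by omega⟩
  have hf : Function.Injective f := Fin.castLE_injective hN
  have hg : Function.Injective g := fun i j h => by
    have := congrArg Fin.val h
    simp only [g] at this
    exact Fin.ext (by omega)
  have hsum : ∀ i, entranceTime v ω (X₀ (f i)) + backwardEntranceTime v ω (X₁ (g i)) < T :=
    fun i => (le_maxSum (i : ℕ) i.2).trans_lt hT
  obtain ⟨σ, τ, s, s', p, hs, hp, hdisj⟩ := exists_disjoint_steeringCurves hd hv hωo hωb hωc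
    (x := X₀ ∘ f) (y := X₁ ∘ g) (hX₀.comp hf) (hX₁.comp hg) (fun i => hx _) (fun i => hy _) hsum
  have hs0 : ∀ i, 0 ≤ s i := fun i => (entranceTime_nonneg _).trans (hs.lt_left i).le
  have hsT : ∀ i, s' i ≤ T := fun i => (hs.lt_right i).le.trans
    (sub_le_self _ (backwardEntranceTime_nonneg _))
  obtain ⟨u, hu, hup, huex⟩ := exists_admissible_of_curves hv hωo hs0 hsT
    (fun i => (hp i).contDiff) (fun i => (hp i).hasDerivAt hv) (fun i => (hp i).mem) hdisj
  obtain ⟨σ₀, hσ₀⟩ := exists_perm_extending hN (hf.comp σ.injective)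
  obtain ⟨σ₁, hσ₁⟩ := exists_perm_extending hN (hg.comp τ.injective)
  have hind : ∀ i : Fin n, ∀ hi : (i : ℕ) < n - R,
      σ₀ i = f (σ ⟨i, hi⟩) ∧ σ₁ i = g (τ ⟨i, hi⟩) := fun i hi => ⟨hσ₀ ⟨i, hi⟩, hσ₁ ⟨i, hi⟩⟩
  -- Agents that are not steered are subject to the same control; any trajectory of theirs will do.
  have htraj : ∀ j : Fin n, ∃ z, IsTrajectory v ω u (X₀ j) z ∧ ∀ i, f (σ i) = j → z = p i := by
    intro j
    by_cases h : ∃ i, f (σ i) = j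
    · obtain ⟨i, rfl⟩ := h
      refine ⟨p i, ?_, fun i' h' => by rw [σ.injective (hf h')]⟩
      have := hup i
      rwa [(hp i).eq_left 0 (hs0 i), hv.flow_zero] at this
    · obtain ⟨z, hz⟩ := huex (X₀ j)
      exact ⟨z, hz, fun i hi => absurd ⟨i, hi⟩ h⟩
  choose z hz hzp using htraj
  refine ⟨σ₀, σ₁, fun i hi => ?_, u, hu, z, hz, fun i hi => ?_⟩
  · rw [(hind i hi).1, (hind i hi).2]
    have h1 := hsum (σ ⟨i, hi⟩)
    have h2 := hsum (τ ⟨i, hi⟩)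
    have h3 := backwardEntranceTime_nonneg (v := v) (ω := ω) (X₁ (g (σ ⟨i, hi⟩)))
    have h4 := entranceTime_nonneg (v := v) (ω := ω) (X₀ (f (τ ⟨i, hi⟩)))
    exact ⟨by linarith, by linarith⟩
  · rw [hzp (σ₀ i) ⟨i, hi⟩ (hind i hi).1.symm, (hp ⟨i, hi⟩).eq_right T (hsT _), add_neg_cancel,
      hv.flow_zero, (hind i hi).2]
    rfl

end Steering

end CrowdControl

/-! ### The main theorem. -/

/-- Let `M = maxSum` be `max_{i ≤ n - R} (t⁰(x⁰ᵢ) + t¹(x¹_{i+R}))`.  Exact steering up to a mass `ε` is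
possible at every time `T > M`, impossible at every `T ∈ (M*_e, M]`, and `M` is the infimum time;
moreover `M = S_ε(μ⁰, μ¹)`. -/
theorem proposition4p3 {d n : ℕ} (hd : 0 < d) (hn : 0 < n)
    (v : CrowdControl.State d → CrowdControl.State d)
    (hvLip : ∃ L : NNReal, LipschitzWith L v) (hvBdd : ∃ M : ℝ, ∀ x, ‖v x‖ ≤ M)
    (ω : Set (CrowdControl.State d))
    (hωo : IsOpen ω) (hωb : Bornology.IsBounded ω) (hωc : IsConnected ω)
    (X₀ X₁ : Fin n → CrowdControl.State d)
    (hX₀ : Function.Injective X₀) (hX₁ : Function.Injective X₁)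
    (hgeom : CrowdControl.GeometricCondition v ω
      (CrowdControl.atomicMeasure (1 / (n : ℝ)) X₀) (CrowdControl.atomicMeasure (1 / (n : ℝ)) X₁))
    (hsort₀ : Monotone fun i => CrowdControl.entranceTime v ω (X₀ i))
    (hsort₁ : Antitone fun i => CrowdControl.backwardEntranceTime v ω (X₁ i))
    (γ ε : ℝ) (hγ : 0 < γ) (hε : 0 ≤ ε) (hεγ : ε < γ) :
    -- steering is possible at every time larger than `M`
    (∀ T, CrowdControl.maxSum v ω X₀ X₁ ε γ < T →
      CrowdControl.SteerableUpTo v ω X₀ X₁ ε γ T) ∧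
    -- steering is impossible at every time in `(M*_e, M]`
    (∀ T, CrowdControl.maxEntrance v ω X₀ X₁ < T → T ≤ CrowdControl.maxSum v ω X₀ X₁ ε γ →
      ¬ CrowdControl.SteerableUpTo v ω X₀ X₁ ε γ T) ∧
    -- the infimum time, with `T` beyond the entrance times of the steered agents and targets
    CrowdControl.infTime v ω X₀ X₁ ε γ = CrowdControl.maxSum v ω X₀ X₁ ε γ ∧
    -- the infimum time, with `T` beyond all entrance times
    CrowdControl.infTimeAll v ω X₀ X₁ ε γ =
      max (CrowdControl.maxEntrance v ω X₀ X₁) (CrowdControl.maxSum v ω X₀ X₁ ε γ) ∧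
    -- the same number is `S_ε` of the associated atomic measures (a supremum of a bounded set)
    BddAbove (CrowdControl.sumSet v ω (CrowdControl.atomicMeasure (γ / (n : ℝ)) X₀)
      (CrowdControl.atomicMeasure (γ / (n : ℝ)) X₁) ε) ∧
    CrowdControl.maxSum v ω X₀ X₁ ε γ =
      CrowdControl.supSum v ω (CrowdControl.atomicMeasure (γ / (n : ℝ)) X₀)
        (CrowdControl.atomicMeasure (γ / (n : ℝ)) X₁) ε := by
  have hv : CrowdControl.GoodField v := ⟨hvLip, hvBdd⟩
  have hn' : (0 : ℝ) < 1 / n := by positivity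
  have hx : ∀ i, ∃ t : ℝ, 0 < t ∧ CrowdControl.flow v t (X₀ i) ∈ ω := fun i =>
    hgeom.1 _ (CrowdControl.mem_support_atomicMeasure hn' X₀ i)
  have hy : ∀ i, ∃ t : ℝ, 0 < t ∧ CrowdControl.flow v (-t) (X₁ i) ∈ ω := fun i =>
    hgeom.2 _ (CrowdControl.mem_support_atomicMeasure hn' X₁ i)
  have hpos : ∀ T, CrowdControl.maxSum v ω X₀ X₁ ε γ < T →
      CrowdControl.SteerableUpTo v ω X₀ X₁ ε γ T := fun T hT => by
    obtain ⟨σ₀, σ₁, _, h⟩ :=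
      CrowdControl.exists_steersVia hd hv hωo hωb hωc hX₀ hX₁ hx hy hT
    exact ⟨σ₀, σ₁, h⟩
  have hmax : ∀ i, CrowdControl.entranceTime v ω (X₀ i) ≤
        CrowdControl.maxEntrance v ω X₀ X₁ ∧
      CrowdControl.backwardEntranceTime v ω (X₁ i) ≤ CrowdControl.maxEntrance v ω X₀ X₁ :=
    fun i => max_le_iff.1 (le_ciSup (f := fun i => max (CrowdControl.entranceTime v ω (X₀ i))
      (CrowdControl.backwardEntranceTime v ω (X₁ i))) (Set.finite_range _).bddAbove i)
  have hneg : ∀ T, CrowdControl.maxEntrance v ω X₀ X₁ < T →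
      CrowdControl.SteerableUpTo v ω X₀ X₁ ε γ T →
      CrowdControl.maxSum v ω X₀ X₁ ε γ < T := by
    rintro T hT ⟨σ₀, σ₁, h⟩
    exact h.maxSum_lt hn hv hωo hx hsort₀ hsort₁ hγ hεγ
      fun i _ => ⟨(hmax _).1.trans_lt hT, (hmax _).2.trans_lt hT⟩
  have hlub := CrowdControl.sumSet_isLUB hn hsort₀ hsort₁ hγ hε hεγ
  refine ⟨hpos, fun T hT hTM h => (hneg T hT h).not_ge hTM, ?_, ?_, hlub.bddAbove, ?_⟩
  · rw [CrowdControl.infTime]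
    -- The times in question form exactly the ray `(M, ∞)`.
    refine Eq.trans (congrArg sInf (Set.ext fun T => ?_)) csInf_Ioi
    constructor
    · rintro ⟨σ₀, σ₁, hT, h⟩
      exact h.maxSum_lt hn hv hωo hx hsort₀ hsort₁ hγ hεγ hT
    · exact fun hT => CrowdControl.exists_steersVia hd hv hωo hωb hωc hX₀ hX₁ hx hy hT
  · rw [CrowdControl.infTimeAll]
    -- Here they form the ray `(max (M*, M), ∞)`.
    refine Eq.trans (congrArg sInf (Set.ext fun T => ?_)) csInf_Ioi
    constructor
    · exact fun hT => max_lt hT.1 (hneg T hT.1 hT.2)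
    · exact fun hT => ⟨(max_lt_iff.1 hT).1, hpos T (max_lt_iff.1 hT).2⟩
  · refine (hlub.csSup_eq ?_).symm
    refine Set.Nonempty.image _ (Set.nonempty_Icc.2 ?_)
    have hn0 : (0 : ℝ) < n := by exact_mod_cast hn
    classical
    rw [CrowdControl.atomicMeasure_real (div_pos hγ hn0).le]
    simp only [Set.mem_univ, Finset.filter_true, Finset.card_univ, Fintype.card_fin]
    rw [div_mul_cancel₀ _ hn0.ne']
    linarith
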